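/- Let $\mathbb K=\mathbb R,\mathbb C$ or $\mathbb H$, $a=\dim_{\mathbb R}\mathbb K$, $r\ge 1$, and let $\mathbb K^{2r}$ be a right $\mathbb K$-vector space with its standard Euclidean structure. Let $\mathcal X=G_{2r,r}(\mathbb K)$ be the Grassmannian of $r$-dimensional $\mathbb K$-subspaces, $\xi_0=\mathbb K^r\oplus 0\in\mathcal X$, and let $d\eta$ be the $U(2r,\mathbb K)$-invariant probability measure on $\mathcal X$. For a square matrix $x$ over $\mathbb K$ let $\det_{\mathbb R}x$ be the determinant of $x$ as a real linear map. For $\xi,\eta\in\mathcal X$ put $$|\mathrm{Sin}(\xi,\eta)|=\left(\frac{\mathrm{vol}_{ra}(P_{\eta^\perp}A)}{\mathrm{vol}_{ra}(A)}\right)^{1/a},$$ where $P_{\eta^\perp}$ is the orthogonal projection onto $\eta^\perp$ and $A$ is the unit ball of $\xi$ (any convex subset of $\xi$ of non-zero finite volume gives the same value). Let $P\subset GL(2r,\mathbb K)$ be the group of block matrices $p=\begin{bmatrix}B&C\\0&D\end{bmatrix}$ with $r\times r$ blocks, and for $s\in\mathbb C$ let $\delta_s(p)=|\det_{\mathbb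 R}(BD^{-1})|^s$. For $Y\in M_{r,r}(\mathbb K)$ let $\bar n_Y=\begin{bmatrix}I&0\\Y&I\end{bmatrix}$. For $t\in\mathbb C$, call a function $\varphi$ on $GL(2r,\mathbb K)$ $t$-induced if $\varphi(gp)=\delta_{t+r/2}(p)^{-1}\varphi(g)$ for all $g\in GL(2r,\mathbb K)$, $p\in P$. Its compact picture is the function $f$ on $\mathcal X$ with $f(k\xi_0)=\varphi(k)$ for $k\in U(2r,\mathbb K)$; its non-compact picture is the function $F(Y)=\varphi(\bar n_Y)$ on $M_{r,r}(\mathbb K)$. The Knapp–Stein operator is given in the non-compact picture, with $dY$ a Lebesgue measure, by $$(\mathcal I_tF)(X)=\int_{M_{r,r}(\mathbb K)}|\det\nolimits_{\mathbb R}(X-Y)|^{-r+2t}F(Y)\,dY .$$ Put $\nu=-\frac a2(r-2t)$ and $$(\mathcal J_tf)(\xi)=\int_{\mathcal X}|\mathrm{Sin}(\xi,\eta)|^{2\nu}f(\eta)\,d\eta .$$ Then: (1) For every $t\in\mathbb C$, $\varphi\mapsto f$ is a bijection from the $t$-induced functions onto the functions on $\mathcal X$, and almost every $\xi\in\mathcal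 X$ is of the form $\bar n_X\xi_0$ with $X\in M_{r,r}(\mathbb K)$. (2) In the compact picture $\mathcal I_t$ is, up to a non-zero constant, $\mathcal J_t$. Precisely, there is a constant $c>0$, depending only on $\mathbb K$, $r$ and the normalization of $dY$, such that for all $t\in\mathbb C$, every measurable $f:\mathcal X\to\mathbb C$ and every $X\in M_{r,r}(\mathbb K)$: if $F$ is the non-compact picture of the $t$-induced function with compact picture $f$, then the integral $(\mathcal I_tF)(X)$ converges absolutely if and only if the integral $(\mathcal J_tf)(\bar n_X\xi_0)$ does, and $$(\mathcal I_tF)(X)=c\,\psi(\bar n_X),$$ where $\psi$ is the $(-t)$-induced function with compact picture $\mathcal J_tf$ (an integral that does not converge absolutely being read as $0$). (3) If $\operatorname{Re}\nu\ge0$ (in particular if $\nu$ is real and $\nu\ge 0$), then $\mathcal J_t$ is well-defined on $L^2(\mathcal X)$: for every $f\in L^2(\mathcal X)$ the integral $(\mathcal J_tf)(\xi)$ converges absolutely for every $\xi\in\mathcal X$, and $f\mapsto\mathcal J_tf$ is a bounded linear operator $L^2(\mathcal X)\to L^2(\mathcal X)$. -/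

import Mathlib

open MeasureTheory
open scoped Matrix MulOpposite

noncomputable section

namespace SineTransform

/-- `K` is one of the fields `ℝ`, `ℂ`, `ℍ`, with its usual conjugation (`star`), its usual real
algebra structure and its usual absolute value. -/
def IsRealComplexOrQuaternion (K : Type*) [NormedDivisionRing K] [NormedAlgebra ℝ K]
    [StarRing K] : Prop :=
  (∃ e : K ≃⋆ₐ[ℝ] ℝ, Isometry e) ∨ (∃ e : K ≃⋆ₐ[ℝ] ℂ, Isometry e) ∨
    (∃ e : K ≃⋆ₐ[ℝ] Quaternion ℝ, Isometry e)

section LinearAlgebra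

variable {K : Type*} [NormedDivisionRing K] [NormedAlgebra ℝ K] [StarRing K]

/-- A matrix acting from the left on column vectors, as a map that is linear for the scalar
multiplication by `K` from the right (`Kᵐᵒᵖ` acting on the left). -/
def mulVecK {m n : Type*} [Fintype n] (A : Matrix m n K) : (n → K) →ₗ[Kᵐᵒᵖ] (m → K) where
  toFun v := A *ᵥ v
  map_add' := Matrix.mulVec_add A
  map_smul' := Matrix.mulVec_smul A

/-- A square matrix as an `ℝ`-linear transformation of the real vector space `K^n`. -/
def mulVecR {n : Type*} [Fintype n] (A : Matrix n n K) : (n → K) →ₗ[ℝ] (n → K) where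
  toFun v := A *ᵥ v
  map_add' := Matrix.mulVec_add A
  map_smul' := Matrix.mulVec_smul A

/-- `det_ℝ A`: the determinant of `A` as a real linear transformation of `K^n`. -/
def detR {n : Type*} [Fintype n] (A : Matrix n n K) : ℝ := LinearMap.det (mulVecR A)

/-- The orthogonal complement `η^⊥` of a (right) `K`-subspace of `K^n`, with respect to the
standard form `⟨x, y⟩ = ∑ i, conj (x i) * y i`. -/
def perp {n : Type*} [Fintype n] (η : Submodule Kᵐᵒᵖ (n → K)) : Submodule Kᵐᵒᵖ (n → K) where
  carrier := {y | ∀ x ∈ η, star x ⬝ᵥ y = 0}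
  add_mem' := fun ha hb x hx => by simp [dotProduct_add, ha x hx, hb x hx]
  zero_mem' := fun x _ => by simp
  smul_mem' := fun c y hy x hx => by
    rw [dotProduct_smul, hy x hx, smul_zero]

/-- The image `P_η(A)` of a set `A` under the orthogonal projection `P_η` of `K^n` onto `η`. -/
def projImage {n : Type*} [Fintype n] (η : Submodule Kᵐᵒᵖ (n → K)) (A : Set (n → K)) :
    Set (n → K) :=
  {w | w ∈ η ∧ ∃ v ∈ A, v - w ∈ perp η}

/-- The `d`-dimensional volume of a subset of the Euclidean space `K^n`, with
`‖x‖ ^ 2 = ∑ i, ‖x i‖ ^ 2`: the `d`-dimensional Hausdorff measure (its normalization does not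
matter, since only quotients of volumes of the same dimension are used). -/
def euclVol {n : Type*} [Fintype n] (d : ℕ) (A : Set (n → K)) : ENNReal :=
  letI : MeasurableSpace (PiLp 2 fun _ : n => K) := borel _
  haveI : BorelSpace (PiLp 2 fun _ : n => K) := ⟨rfl⟩
  Measure.hausdorffMeasure (d : ℝ)
    ((WithLp.toLp 2 : (n → K) → PiLp 2 fun _ : n => K) '' A)

/-- The Euclidean unit ball of the subspace `ξ`. -/
def unitBall {n : Type*} [Fintype n] (ξ : Submodule Kᵐᵒᵖ (n → K)) : Set (n → K) :=
  {v | v ∈ ξ ∧ ∑ i, ‖v i‖ ^ 2 ≤ 1}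

/-- `|Cos(ξ, η)| = (vol (P_η A) / vol A) ^ (1 / a)`, `a = dim_ℝ K`, for subspaces with
`dim ξ ≤ dim η`; the volume is of the real dimension of `ξ`. The quotient is the same for all
convex `A ⊆ ξ` of non-zero (finite) volume; here `A` is the unit ball of `ξ`. -/
def cosAngle {n : Type*} [Fintype n] (ξ η : Submodule Kᵐᵒᵖ (n → K)) : ℝ :=
  (euclVol (Module.finrank ℝ K * Module.finrank Kᵐᵒᵖ ξ) (projImage η (unitBall ξ)) /
    euclVol (Module.finrank ℝ K * Module.finrank Kᵐᵒᵖ ξ) (unitBall ξ)).toReal ^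
      ((1 : ℝ) / Module.finrank ℝ K)

/-- `|Sin(ξ, η)| = |Cos(ξ, η^⊥)|`, for subspaces with `dim ξ ≤ n - dim η`. -/
def sinAngle {n : Type*} [Fintype n] (ξ η : Submodule Kᵐᵒᵖ (n → K)) : ℝ :=
  cosAngle ξ (perp η)

end LinearAlgebra

section Grassmannian

variable (K : Type*) [NormedDivisionRing K] [NormedAlgebra ℝ K] [StarRing K] (r : ℕ)

/-- The group `GL(2r, K)`, matrices being written in `r × r` blocks. -/
abbrev GL2r : Type _ := (Matrix (Fin r ⊕ Fin r) (Fin r ⊕ Fin r) K)ˣ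

/-- The group `U(2r, K)`, i.e. `O(2r)`, `U(2r)`, `Sp(2r)` for `K = ℝ, ℂ, ℍ`. -/
abbrev U2r : Type _ := ↥(unitary (Matrix (Fin r ⊕ Fin r) (Fin r ⊕ Fin r) K))

/-- The Grassmannian `G_{2r,r}(K)` of `r`-dimensional `K`-subspaces of `K^{2r}`. -/
def Gr : Type _ :=
  {ξ : Submodule Kᵐᵒᵖ (Fin r ⊕ Fin r → K) // Module.finrank Kᵐᵒᵖ ξ = r}

variable {K r}

/-- An invertible matrix acting on `K^{2r}` as a linear automorphism. -/
def glEquiv (g : GL2r K r) : (Fin r ⊕ Fin r → K) ≃ₗ[Kᵐᵒᵖ] (Fin r ⊕ Fin r → K) :=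
  { mulVecK (g : Matrix (Fin r ⊕ Fin r) (Fin r ⊕ Fin r) K) with
    invFun := fun v => ((g⁻¹ : GL2r K r) : Matrix (Fin r ⊕ Fin r) (Fin r ⊕ Fin r) K) *ᵥ v
    left_inv := fun v => by simp [mulVecK]
    right_inv := fun v => by simp [mulVecK] }

/-- The defining action of `GL(2r, K)` on the Grassmannian. -/
def Gr.act (g : GL2r K r) (ξ : Gr K r) : Gr K r :=
  ⟨ξ.1.map (glEquiv g).toLinearMap, by rw [LinearEquiv.finrank_map_eq]; exact ξ.2⟩

/-- The projection of `K^{2r} = K^r ⊕ K^r` onto its second summand. -/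
def sndProj : (Fin r ⊕ Fin r → K) →ₗ[Kᵐᵒᵖ] (Fin r → K) :=
  LinearMap.funLeft Kᵐᵒᵖ K Sum.inr

variable (K r) in
theorem finrank_base :
    Module.finrank Kᵐᵒᵖ (LinearMap.ker (sndProj (K := K) (r := r))) = r := by
  have hs : LinearMap.range (sndProj (K := K) (r := r)) = ⊤ :=
    LinearMap.range_eq_top.2
      (LinearMap.funLeft_surjective_of_injective _ _ _ Sum.inr_injective)
  have hf : Module.finrank Kᵐᵒᵖ K = 1 := by
    rw [(MulOpposite.opLinearEquiv Kᵐᵒᵖ : K ≃ₗ[Kᵐᵒᵖ] Kᵐᵒᵖ).finrank_eq]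
    exact Module.finrank_self _
  have : Module.Finite Kᵐᵒᵖ K :=
    Module.Finite.equiv (MulOpposite.opLinearEquiv Kᵐᵒᵖ : K ≃ₗ[Kᵐᵒᵖ] Kᵐᵒᵖ).symm
  have h := LinearMap.finrank_range_add_finrank_ker (sndProj (K := K) (r := r))
  rw [hs, finrank_top, Module.finrank_pi_fintype, Module.finrank_pi_fintype] at h
  simp [hf] at h
  omega

variable (K r) in
/-- The base point `ξ₀ = K^r ⊕ 0`. -/
def Gr.base : Gr K r := ⟨LinearMap.ker sndProj, finrank_base K r⟩

/-- The Grassmannian carries the topology of the homogeneous space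
`U(2r, K) / (U(r, K) × U(r, K))`: the quotient topology for `k ↦ k ξ₀`. -/
instance : TopologicalSpace (Gr K r) :=
  TopologicalSpace.coinduced (fun k : U2r K r => Gr.act (Unitary.toUnits k) (Gr.base K r))
    inferInstance

instance : MeasurableSpace (Gr K r) := borel _

instance : BorelSpace (Gr K r) := ⟨rfl⟩

/-- `μ` is invariant under `U(2r, K)`. -/
def IsUInvariant (μ : Measure (Gr K r)) : Prop :=
  ∀ k : U2r K r, μ.map (Gr.act (Unitary.toUnits k)) = μ

/-- The integrand `η ↦ |Sin(ξ, η)|^{2ν} f(η)` of the sine transform. -/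
def sineIntegrand (ν : ℂ) (f : Gr K r → ℂ) (ξ η : Gr K r) : ℂ :=
  ((sinAngle ξ.1 η.1 : ℝ) : ℂ) ^ (2 * ν) * f η

/-- The sine transform `∫ |Sin(ξ, η)|^{2ν} f(η) dη` on functions on `G_{2r,r}(K)`. -/
def sineTransform (μ : Measure (Gr K r)) (ν : ℂ) (f : Gr K r → ℂ) (ξ : Gr K r) : ℂ :=
  ∫ η, sineIntegrand ν f ξ η ∂μ

end Grassmannian

section Induced

variable {K : Type*} [NormedDivisionRing K] [NormedAlgebra ℝ K] [StarRing K] {r : ℕ}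

variable (K r) in
/-- The parabolic subgroup `P` of block upper triangular matrices (as a set). -/
def parabolic : Set (GL2r K r) :=
  {p | (p : Matrix (Fin r ⊕ Fin r) (Fin r ⊕ Fin r) K).toBlocks₂₁ = 0}

/-- The character `δ_s(p) = |det_ℝ (B D⁻¹)|^s` of `P`, where `p = [[B, C], [0, D]]`. -/
def delta (s : ℂ) (p : GL2r K r) : ℂ :=
  ((|detR ((p : Matrix (Fin r ⊕ Fin r) (Fin r ⊕ Fin r) K).toBlocks₁₁ *
    Ring.inverse (p : Matrix (Fin r ⊕ Fin r) (Fin r ⊕ Fin r) K).toBlocks₂₂)| : ℝ) : ℂ) ^ s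

/-- The transformation law `φ(g p) = δ_{t + r/2}(p)⁻¹ φ(g)` of the functions on `GL(2r, K)` in
the representation space of `Ind_P^{GL(2r, K)}(t)`. -/
def IsInduced (t : ℂ) (φ : GL2r K r → ℂ) : Prop :=
  ∀ g p : GL2r K r, p ∈ parabolic K r → φ (g * p) = (delta (t + (r : ℂ) / 2) p)⁻¹ * φ g

/-- `f` is the compact picture of `φ`: the restriction of `φ` to `U(2r, K)`, viewed as a
function on the Grassmannian by `k ↦ k ξ₀`. -/
def HasCompactPicture (φ : GL2r K r → ℂ) (f : Gr K r → ℂ) : Prop :=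
  ∀ k : U2r K r, φ (Unitary.toUnits k) = f (Gr.act (Unitary.toUnits k) (Gr.base K r))

/-- The element `[[I, 0], [Y, I]]` of the opposite nilpotent group. -/
def nbar (Y : Matrix (Fin r) (Fin r) K) : GL2r K r where
  val := Matrix.fromBlocks 1 0 Y 1
  inv := Matrix.fromBlocks 1 0 (-Y) 1
  val_inv := by simp [Matrix.fromBlocks_multiply]
  inv_val := by simp [Matrix.fromBlocks_multiply]

/-- The non-compact picture of `φ`: its restriction to the opposite nilpotent group, which is
identified with the matrices `M_{r,r}(K)`. -/
def noncompactPicture (φ : GL2r K r → ℂ) (Y : Matrix (Fin r) (Fin r) K) : ℂ := φ (nbar Y)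

/-- The integrand `Y ↦ |det_ℝ (X - Y)|^{-r + 2t} F(Y)` of the Knapp-Stein operator. -/
def knappSteinIntegrand (t : ℂ) (F : Matrix (Fin r) (Fin r) K → ℂ)
    (X Y : Matrix (Fin r) (Fin r) K) : ℂ :=
  ((|detR (X - Y)| : ℝ) : ℂ) ^ (-(r : ℂ) + 2 * t) * F Y

/-- The Knapp-Stein operator in the non-compact picture,
`(I_t F)(X) = ∫ |det_ℝ (X - Y)|^{-r + 2t} F(Y) dY`. -/
def knappStein [MeasurableSpace (Matrix (Fin r) (Fin r) K)]
    (dY : Measure (Matrix (Fin r) (Fin r) K)) (t : ℂ) (F : Matrix (Fin r) (Fin r) K → ℂ)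
    (X : Matrix (Fin r) (Fin r) K) : ℂ :=
  ∫ Y, knappSteinIntegrand t F X Y ∂dY

variable (K r) in
/-- The parameter `ν = -(a/2)(r - 2t)`, `a = dim_ℝ K`. -/
def nuOf (t : ℂ) : ℂ := -((Module.finrank ℝ K : ℂ) / 2) * ((r : ℂ) - 2 * t)

end Induced

end SineTransform

end

set_option linter.unusedSectionVars false

noncomputable section

namespace SineTransform

/-! Both operators are integral operators with the same kernel, seen in two pictures. All that is
used of the scalars is that `K` is finite-dimensional over `ℝ` and `star x * x = ‖x‖ ^ 2`, so the
three fields are treated at once (`IsHurwitz`).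

Let F be the first r columns of g. The function `cocycle g`, which is |det_ℝ(F*F)| / |det_ℝ g|, is 1
on the unitary group and is multiplied by |det_ℝ(B D⁻¹)| under right translation by P. Since GL =
U·P, the induced function with compact picture f must be `cocycle g` to the power -(s + r/2), times
f(gξ₀); this is statement (1).

In the chart Y ↦ n̄_Y ξ₀ everything is governed by one weight w(Y), the square root of `cocycle
(nbar Y)`. First, |Sin(n̄_X ξ₀, n̄_Y ξ₀)|^a = |det_ℝ(X - Y)| / (w(X) w(Y)) (`sinAngle_nbar`).
Second, up to a positive constant, the invariant measure is w(Y)^(-2r) dY (`exists_map_chart_eq`).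
Third, F(Y) = w(Y)^(-2t - r) f(n̄_Y ξ₀) (`inducedOf_nbar`). As 2ν = a(-r + 2t), the Knapp–Stein
integrand is w(X)^(-r + 2t) times the sine integrand times w(Y)^(-2r) (`knappSteinIntegrand_eq`),
and w(X)^(-r + 2t) is precisely the factor of a (-t)-induced function. This is statement (2).

The density comes from Lebesgue measure on pairs [A; C] cut down to a bounded unitarily invariant
set: its image under the column span is a finite invariant measure, hence a multiple of μ by a
Fubini argument against Haar measure on U (`IsUInvariant.eq_smul`), while the substitution C = Y A
computes the same image in the chart (`map_spanPair_eq`).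

For (3), |Sin| ≤ 1, so the kernel is bounded by 1 when Re ν ≥ 0, and μ is a probability measure. -/

/-- A finite-dimensional real normed division algebra with an involution for which
`star x * x = ‖x‖²`. -/
class IsHurwitz (K : Type*) [NormedDivisionRing K] [NormedAlgebra ℝ K] [StarRing K] : Prop where
  finiteDimensional : FiniteDimensional ℝ K
  star_mul_self (x : K) : star x * x = algebraMap ℝ K (‖x‖ ^ 2)

theorem IsRealComplexOrQuaternion.isHurwitz {K : Type*} [NormedDivisionRing K]
    [NormedAlgebra ℝ K] [StarRing K] (hK : IsRealComplexOrQuaternion K) : IsHurwitz K := by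
  rcases hK with ⟨e, he⟩ | ⟨e, he⟩ | ⟨e, he⟩
  all_goals
    have hn : ∀ x, ‖e x‖ = ‖x‖ := fun x => by
      simpa using he.dist_eq x 0
    have hm : ∀ x y, e (x * y) = e x * e y := map_mul e
    have hs : ∀ x, e (star x) = star (e x) := map_star e
    have he' : ∀ c : ℝ, e (algebraMap ℝ K c) = algebraMap ℝ _ c := fun c => by
      rw [Algebra.algebraMap_eq_smul_one, map_smul, map_one, Algebra.algebraMap_eq_smul_one]
    refine ⟨?_, fun x => ?_⟩
  · exact LinearEquiv.finiteDimensional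
      ({ e with map_smul' := fun c x => map_smul e c x } : K ≃ₗ[ℝ] ℝ).symm
  · apply EquivLike.injective e
    rw [hm, hs, he', ← hn]
    simp [sq]
  · exact LinearEquiv.finiteDimensional
      ({ e with map_smul' := fun c x => map_smul e c x } : K ≃ₗ[ℝ] ℂ).symm
  · apply EquivLike.injective e
    rw [hm, hs, he', ← hn]
    simp [Complex.conj_mul']
  · exact LinearEquiv.finiteDimensional
      ({ e with map_smul' := fun c x => map_smul e c x } : K ≃ₗ[ℝ] Quaternion ℝ).symm
  · apply EquivLike.injective e
    rw [map_mul, map_star, he', ← hn, Quaternion.star_mul_self, sq,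
      Quaternion.normSq_eq_norm_mul_self]
    rfl

/-! ### Conjugation and the standard Hermitian form -/

section Basic

variable {K : Type*} [NormedDivisionRing K] [NormedAlgebra ℝ K] [StarRing K] [IsHurwitz K]

instance : FiniteDimensional ℝ K := IsHurwitz.finiteDimensional

instance : CompleteSpace K := FiniteDimensional.complete ℝ K

instance : ProperSpace K := FiniteDimensional.proper ℝ K

theorem norm_star_eq (x : K) : ‖star x‖ = ‖x‖ := by
  by_cases hx : x = 0
  · simp [hx]
  · have h := congrArg norm (IsHurwitz.star_mul_self x)
    rw [norm_mul, norm_algebraMap', norm_pow, norm_norm, sq] at h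
    exact mul_right_cancel₀ (norm_ne_zero_iff.2 hx) h

theorem star_algebraMap_eq (c : ℝ) : star (algebraMap ℝ K c) = algebraMap ℝ K c := by
  by_cases hc : c = 0
  · simp [hc]
  · have h := IsHurwitz.star_mul_self (algebraMap ℝ K c)
    rw [norm_algebraMap', Real.norm_eq_abs, sq_abs, sq, map_mul] at h
    exact mul_right_cancel₀ (by simpa using hc) h

instance : StarModule ℝ K where
  star_smul c x := by
    rw [Algebra.smul_def, star_mul, star_algebraMap_eq, Algebra.smul_def, Algebra.commutes]
    simp

instance : NormedStarGroup K := ⟨fun x => (norm_star_eq x).le⟩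

theorem star_dotProduct_self {n : Type*} [Fintype n] (v : n → K) :
    star v ⬝ᵥ v = algebraMap ℝ K (∑ i, ‖v i‖ ^ 2) := by
  simp [dotProduct, IsHurwitz.star_mul_self, map_sum]

theorem star_dotProduct_self_eq_zero {n : Type*} [Fintype n] {v : n → K} :
    star v ⬝ᵥ v = 0 ↔ v = 0 := by
  rw [star_dotProduct_self]
  constructor
  · intro h
    have h2 : ∑ i, ‖v i‖ ^ 2 = 0 := (algebraMap ℝ K).injective (by rw [h, map_zero])
    rw [Finset.sum_eq_zero_iff_of_nonneg (fun i _ => by positivity)] at h2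
    ext i
    simpa using h2 i (Finset.mem_univ i)
  · rintro rfl
    simp

end Basic

/-! ### The real determinant of matrices over `K` -/

section DetR

variable {K : Type*} [NormedDivisionRing K] [NormedAlgebra ℝ K] [StarRing K]
variable {n : Type*} [Fintype n]

theorem mulVecR_mul (A B : Matrix n n K) : mulVecR (A * B) = mulVecR A * mulVecR B := by
  ext v : 1
  simp [mulVecR, Matrix.mulVec_mulVec]

theorem mulVecR_apply (A : Matrix n n K) (v : n → K) : mulVecR A v = A *ᵥ v := rfl

theorem detR_mul (A B : Matrix n n K) : detR (A * B) = detR A * detR B := by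
  simp [detR, mulVecR_mul]

theorem detR_one [DecidableEq n] : detR (1 : Matrix n n K) = 1 := by
  have : mulVecR (1 : Matrix n n K) = LinearMap.id := by
    apply LinearMap.ext; intro v; simp [mulVecR]
  simp [detR, this]

theorem detR_ne_zero_of_isUnit [DecidableEq n] {A : Matrix n n K} (h : IsUnit A) :
    detR A ≠ 0 := by
  obtain ⟨u, rfl⟩ := h
  intro h0
  have : detR ((u : Matrix n n K) * (↑u⁻¹ : Matrix n n K)) = 1 := by
    rw [Units.mul_inv, detR_one]
  rw [detR_mul, h0, zero_mul] at this
  exact zero_ne_one this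

/-- By dimension count the map is onto, and preimages of the standard basis are the columns of a
right inverse; over a division ring a one-sided inverse of a square matrix is two-sided. -/
theorem isUnit_of_mulVec_injective [DecidableEq n] {A : Matrix n n K}
    (h : ∀ v, A *ᵥ v = 0 → v = 0) : IsUnit A := by
  have hinj : Function.Injective (mulVecK A) := by
    rw [← LinearMap.ker_eq_bot, LinearMap.ker_eq_bot']
    exact h
  have : Module.Finite Kᵐᵒᵖ K :=
    Module.Finite.equiv (MulOpposite.opLinearEquiv Kᵐᵒᵖ : K ≃ₗ[Kᵐᵒᵖ] Kᵐᵒᵖ).symm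
  have hsurj : Function.Surjective (mulVecK A) := LinearMap.injective_iff_surjective.1 hinj
  choose b hb using fun i : n => hsurj (Pi.single i 1)
  have hAB : A * (Matrix.of fun i j => b j i) = 1 := by
    ext i j
    have := congrFun (hb j) i
    rw [Matrix.mul_apply]
    simp only [mulVecK, LinearMap.coe_mk, AddHom.coe_mk, Matrix.mulVec, dotProduct] at this
    simp only [Matrix.of_apply, this, Matrix.one_apply, Pi.single_apply]
  exact ⟨⟨A, _, hAB, mul_eq_one_comm.1 hAB⟩, rfl⟩

theorem isUnit_of_detR_ne_zero [DecidableEq n] [FiniteDimensional ℝ K]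
    {A : Matrix n n K} (h : detR A ≠ 0) :
    IsUnit A := by
  apply isUnit_of_mulVec_injective
  intro v hv
  have hu : IsUnit (mulVecR A) := by
    rw [LinearMap.isUnit_iff_isUnit_det]; exact isUnit_iff_ne_zero.2 h
  have := LinearMap.ker_eq_bot'.1 ((LinearMap.isUnit_iff_ker_eq_bot _).1 hu) v hv
  exact this

theorem isUnit_iff_detR_ne_zero [DecidableEq n] [FiniteDimensional ℝ K]
    {A : Matrix n n K} : IsUnit A ↔ detR A ≠ 0 :=
  ⟨detR_ne_zero_of_isUnit, isUnit_of_detR_ne_zero⟩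

theorem detR_inverse [DecidableEq n] {A : Matrix n n K} (h : IsUnit A) :
    detR (Ring.inverse A) = (detR A)⁻¹ := by
  have : detR (A * Ring.inverse A) = 1 := by rw [Ring.mul_inverse_cancel A h, detR_one]
  rw [detR_mul] at this
  exact eq_inv_of_mul_eq_one_right this

theorem continuous_detR [FiniteDimensional ℝ K] : Continuous (detR : Matrix n n K → ℝ) := by
  classical
  let L : Matrix n n K →ₗ[ℝ] ((n → K) →ₗ[ℝ] (n → K)) :=
    { toFun := mulVecR
      map_add' := fun A B => by apply LinearMap.ext; intro v; simp [mulVecR, Matrix.add_mulVec]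
      map_smul' := fun c A => by apply LinearMap.ext; intro v; simp [mulVecR, Matrix.smul_mulVec] }
  let b := Module.finBasis ℝ (n → K)
  have : (detR : Matrix n n K → ℝ) = fun A => Matrix.det (LinearMap.toMatrix b b (L A)) := by
    ext A
    rw [LinearMap.det_toMatrix]
    rfl
  rw [this]
  have : Continuous fun A => LinearMap.toMatrix b b (L A) :=
    ((LinearMap.toMatrix b b).toLinearMap ∘ₗ L).continuous_of_finiteDimensional
  exact this.matrix_det

/-- Left multiplication by a matrix, as a real linear map. -/
def leftMul (m : Type*) (A : Matrix n n K) : Matrix n m K →ₗ[ℝ] Matrix n m K where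
  toFun B := A * B
  map_add' := Matrix.mul_add A
  map_smul' c B := Matrix.mul_smul A c B

/-- Right multiplication by a matrix, as a real linear map. -/
def rightMul (m : Type*) (A : Matrix n n K) : Matrix m n K →ₗ[ℝ] Matrix m n K where
  toFun B := B * A
  map_add' B C := Matrix.add_mul B C A
  map_smul' c B := Matrix.smul_mul c B A

/-- The matrix `A` acts separately on each of the m columns. -/
theorem det_leftMul [FiniteDimensional ℝ K] {m : Type*} [Fintype m] (A : Matrix n n K) :
    LinearMap.det (leftMul m A) = detR A ^ Fintype.card m := by
  let e : Matrix n m K ≃ₗ[ℝ] (m → n → K) :=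
    Matrix.transposeLinearEquiv n m ℝ K
  rw [← LinearMap.det_conj _ e]
  have : (e.toLinearMap ∘ₗ leftMul m A ∘ₗ e.symm.toLinearMap) =
      LinearMap.pi fun i => mulVecR A ∘ₗ LinearMap.proj i := by
    ext v : 1
    funext i j
    rfl
  rw [this, LinearMap.det_pi]
  simp [detR]

/-- The trace of the left multiplication by an element of `K`. -/
def realTrace (K : Type*) [NormedDivisionRing K] [NormedAlgebra ℝ K] : K →ₗ[ℝ] ℝ :=
  LinearMap.trace ℝ K ∘ₗ (Algebra.lmul ℝ K).toLinearMap

theorem realTrace_one [FiniteDimensional ℝ K] : realTrace K 1 ≠ 0 := by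
  have := Module.finrank_pos (R := ℝ) (M := K)
  have h : LinearMap.mul ℝ K 1 = LinearMap.id := by ext; simp
  simp [realTrace, h, this.ne']

/-- The nondegenerate real pairing `(U, V) ↦ tr_ℝ (tr (U V))`. -/
def tracePairing (K : Type*) [NormedDivisionRing K] [NormedAlgebra ℝ K]
    (m n : Type*) [Fintype n] [Fintype m] :
    Matrix m n K →ₗ[ℝ] Module.Dual ℝ (Matrix n m K) :=
  LinearMap.mk₂ ℝ (fun U V => realTrace K (Matrix.trace (U * V)))
    (by intros; simp [Matrix.add_mul]) (by intros; simp)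
    (by intros; simp [Matrix.mul_add]) (by intros; simp)

theorem tracePairing_injective [FiniteDimensional ℝ K] (m n : Type*) [Fintype n] [Fintype m] :
    Function.Injective (tracePairing K m n) := by
  classical
  rw [← LinearMap.ker_eq_bot, LinearMap.ker_eq_bot']
  intro U hU
  ext i j
  by_contra h
  have h1 := LinearMap.congr_fun hU (Matrix.single j i (U i j)⁻¹)
  have h2 : Matrix.trace (U * Matrix.single j i (U i j)⁻¹) = 1 := by
    rw [Matrix.trace, Finset.sum_eq_single i]
    · simp [mul_inv_cancel₀ h]
    · intro k _ hk
      simp [hk]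
    · simp
  apply realTrace_one (K := K)
  rw [← h2]
  exact h1

/-- Under the trace pairing, right multiplication by `A` is the transpose of left multiplication by
`A`. Passing to rows by plain transposition would fail for quaternions, where transposition does not
reverse products. -/
theorem det_rightMul [FiniteDimensional ℝ K] {m : Type*} [Fintype m] (A : Matrix n n K) :
    LinearMap.det (rightMul m A) = detR A ^ Fintype.card m := by
  have hd : Module.finrank ℝ (Matrix m n K) = Module.finrank ℝ (Module.Dual ℝ (Matrix n m K)) := by
    rw [Subspace.dual_finrank_eq, Module.finrank_matrix, Module.finrank_matrix]; ring
  let e : Matrix m n K ≃ₗ[ℝ] Module.Dual ℝ (Matrix n m K) :=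
    LinearEquiv.ofInjectiveOfFinrankEq (tracePairing K m n) (tracePairing_injective m n) hd
  rw [← det_leftMul, ← LinearMap.det_dualMap (leftMul m A), ← LinearMap.det_conj (rightMul m A) e]
  congr 1
  apply LinearMap.ext
  intro φ
  obtain ⟨U, rfl⟩ := e.surjective φ
  ext V : 1
  simp only [LinearMap.comp_apply, LinearEquiv.coe_coe, LinearEquiv.symm_apply_apply]
  change realTrace K (Matrix.trace (U * A * V)) = realTrace K (Matrix.trace (U * (A * V)))
  rw [Matrix.mul_assoc]

/-- Conjugate transposition intertwines right multiplication by `A` on a single row with left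
multiplication by `Aᴴ` on a single column. -/
theorem detR_conjTranspose [IsHurwitz K] (A : Matrix n n K) : detR Aᴴ = detR A := by
  have h1 := det_rightMul (m := Unit) A
  have h2 := det_leftMul (m := Unit) Aᴴ
  rw [Fintype.card_unit, pow_one] at h1 h2
  rw [← h1, ← h2]
  let e : Matrix Unit n K ≃ₗ[ℝ] Matrix n Unit K :=
    { toFun := fun U => Uᴴ
      invFun := fun U => Uᴴ
      left_inv := fun U => by simp
      right_inv := fun U => by simp
      map_add' := by intros; simp
      map_smul' := by intros; simp }
  rw [← LinearMap.det_conj (rightMul Unit A) e]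
  congr 1
  apply LinearMap.ext
  intro U
  simp [e, leftMul, rightMul]

theorem detR_conjTranspose_mul_self [IsHurwitz K] (A : Matrix n n K) :
    detR (Aᴴ * A) = detR A ^ 2 := by
  rw [detR_mul, detR_conjTranspose, sq]

theorem abs_detR_unitary [DecidableEq n] [IsHurwitz K] {k : Matrix n n K}
    (hk : k ∈ unitary (Matrix n n K)) : |detR k| = 1 := by
  have h := detR_conjTranspose_mul_self k
  rw [← Matrix.star_eq_conjTranspose, Unitary.star_mul_self_of_mem hk, detR_one] at h
  rwa [← sq_eq_sq₀ (abs_nonneg _) zero_le_one, sq_abs, one_pow, eq_comm]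

end DetR

/-! ### Real determinants of block triangular matrices -/

section Blocks

variable {K : Type*} [NormedDivisionRing K] [NormedAlgebra ℝ K] [StarRing K]
variable {m n : Type*} [Fintype n] [Fintype m] [DecidableEq m] [DecidableEq n]

theorem detR_fromBlocks_diagonal [FiniteDimensional ℝ K] (B : Matrix m m K) (D : Matrix n n K) :
    detR (Matrix.fromBlocks B 0 0 D) = detR B * detR D := by
  let e : (m ⊕ n → K) ≃ₗ[ℝ] (m → K) × (n → K) := LinearEquiv.sumArrowLequivProdArrow m n ℝ K
  rw [detR, ← LinearMap.det_conj _ e]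
  have : (e.toLinearMap ∘ₗ mulVecR (Matrix.fromBlocks B 0 0 D) ∘ₗ e.symm.toLinearMap) =
      LinearMap.prodMap (mulVecR B) (mulVecR D) := by
    apply LinearMap.ext
    rintro ⟨u, v⟩
    ext i
    · simp [mulVecR, e, Matrix.fromBlocks_mulVec, LinearEquiv.sumArrowLequivProdArrow]
      rfl
    · simp [mulVecR, e, Matrix.fromBlocks_mulVec, LinearEquiv.sumArrowLequivProdArrow]
      rfl
  rw [this, LinearMap.det_prodMap]
  rfl

/-- Conjugation by diag(2, 1) doubles `C`, and so does squaring the matrix. The determinant thus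
equals its own square, and it is not zero. -/
theorem detR_fromBlocks_one_upper [FiniteDimensional ℝ K] (C : Matrix m n K) :
    detR (Matrix.fromBlocks 1 C 0 1) = 1 := by
  have h2 : detR (Matrix.fromBlocks 1 C 0 1) * detR (Matrix.fromBlocks 1 C 0 1) =
      detR (Matrix.fromBlocks 1 C 0 1) := by
    have hinv : Matrix.fromBlocks ((2:ℝ) • (1 : Matrix m m K)) 0 0 (1 : Matrix n n K) *
        Matrix.fromBlocks ((2:ℝ)⁻¹ • (1 : Matrix m m K)) 0 0 (1 : Matrix n n K) = 1 := by
      simp [Matrix.fromBlocks_multiply, smul_smul]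
    have hconj : Matrix.fromBlocks 1 C 0 1 * Matrix.fromBlocks 1 C 0 1 =
        Matrix.fromBlocks ((2:ℝ) • (1 : Matrix m m K)) 0 0 (1 : Matrix n n K) *
          Matrix.fromBlocks 1 C 0 1 *
          Matrix.fromBlocks ((2:ℝ)⁻¹ • (1 : Matrix m m K)) 0 0 (1 : Matrix n n K) := by
      simp [Matrix.fromBlocks_multiply, two_smul ℝ C]
    have h := congrArg detR hinv
    rw [detR_mul, detR_one] at h
    rw [← detR_mul, hconj, detR_mul, detR_mul, mul_right_comm, h, one_mul]
  have h0 : detR (Matrix.fromBlocks 1 C 0 1) ≠ 0 := by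
    apply detR_ne_zero_of_isUnit
    refine ⟨⟨Matrix.fromBlocks 1 C 0 1, Matrix.fromBlocks 1 (-C) 0 1, ?_, ?_⟩, rfl⟩ <;>
      simp [Matrix.fromBlocks_multiply]
  exact mul_left_cancel₀ h0 (by rw [h2, mul_one])

theorem detR_fromBlocks_one_lower [IsHurwitz K] (C : Matrix n m K) :
    detR (Matrix.fromBlocks 1 0 C 1) = 1 := by
  rw [← detR_conjTranspose, Matrix.fromBlocks_conjTranspose, Matrix.conjTranspose_one,
    Matrix.conjTranspose_one, Matrix.conjTranspose_zero, detR_fromBlocks_one_upper]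

end Blocks

/-! ### Orthonormal families in right `K`-subspaces -/

section GramSchmidt

variable {K : Type*} [NormedDivisionRing K] [NormedAlgebra ℝ K] [StarRing K]

instance : Module.Finite Kᵐᵒᵖ K :=
  Module.Finite.equiv (MulOpposite.opLinearEquiv Kᵐᵒᵖ : K ≃ₗ[Kᵐᵒᵖ] Kᵐᵒᵖ).symm

theorem finrank_pi_op (n : Type*) [Fintype n] :
    Module.finrank Kᵐᵒᵖ (n → K) = Fintype.card n := by
  have hf : Module.finrank Kᵐᵒᵖ K = 1 := by
    rw [(MulOpposite.opLinearEquiv Kᵐᵒᵖ : K ≃ₗ[Kᵐᵒᵖ] Kᵐᵒᵖ).finrank_eq]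
    exact Module.finrank_self _
  rw [Module.finrank_pi_fintype]
  simp [hf]

variable {n : Type*} [Fintype n]

theorem star_dotProduct_comm_zero {u v : n → K} (h : star u ⬝ᵥ v = 0) : star v ⬝ᵥ u = 0 := by
  rw [Matrix.star_dotProduct, h, star_zero]

/-- There are fewer linear conditions than dimensions, so some nonzero vector satisfies them all; it
is then normalized by a real scalar, which is central. -/
theorem exists_unit_orthogonal [IsHurwitz K] {ι : Type*} [Fintype ι] (e : ι → n → K)
    (ξ : Submodule Kᵐᵒᵖ (n → K)) (h : Fintype.card ι < Module.finrank Kᵐᵒᵖ ξ) :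
    ∃ v ∈ ξ, star v ⬝ᵥ v = 1 ∧ ∀ i, star (e i) ⬝ᵥ v = 0 := by
  let L : ξ →ₗ[Kᵐᵒᵖ] (ι → K) :=
    { toFun := fun v i => star (e i) ⬝ᵥ (v : n → K)
      map_add' := fun u v => by ext i; simp [dotProduct_add]
      map_smul' := fun c v => by ext i; simp [dotProduct_smul] }
  have hker : LinearMap.ker L ≠ ⊥ :=
    LinearMap.ker_ne_bot_of_finrank_lt (by rwa [finrank_pi_op])
  obtain ⟨v, hv, hv0⟩ := (Submodule.ne_bot_iff _).1 hker
  have hv1 : ∀ i, star (e i) ⬝ᵥ (v : n → K) = 0 := fun i => congrFun hv i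
  have hv2 : (v : n → K) ≠ 0 := fun h => hv0 (Subtype.ext h)
  set s : ℝ := ∑ i, ‖(v : n → K) i‖ ^ 2 with hs
  have hs0 : 0 ≤ s := Finset.sum_nonneg fun i _ => by positivity
  have hs1 : s ≠ 0 := fun h => hv2 (star_dotProduct_self_eq_zero.1 (by
    rw [star_dotProduct_self, ← hs, h, map_zero]))
  set c : ℝ := (Real.sqrt s)⁻¹ with hc
  have hcs : c * c * s = 1 := by
    rw [hc, ← mul_inv, Real.mul_self_sqrt hs0, inv_mul_cancel₀ hs1]
  refine ⟨MulOpposite.op (algebraMap ℝ K c) • (v : n → K), ξ.smul_mem _ v.2, ?_, fun i => ?_⟩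
  · have : MulOpposite.op (algebraMap ℝ K c) • (v : n → K) = c • (v : n → K) := by
      ext i
      simp [Algebra.smul_def, Algebra.commutes]
    rw [this, star_smul, smul_dotProduct, dotProduct_smul, star_dotProduct_self, ← hs, smul_smul,
      star_trivial, Algebra.smul_def, ← map_mul, hcs, map_one]
  · rw [dotProduct_smul, hv1, smul_zero]

/-- Gram–Schmidt. The family `e₀` of prescribed orthogonality conditions allows a second use that
completes an orthonormal basis of a subspace to one of the whole space. -/
theorem exists_orthonormal_family [IsHurwitz K] {ι : Type*} [Fintype ι] (e₀ : ι → n → K)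
    (ξ : Submodule Kᵐᵒᵖ (n → K)) (d : ℕ) (h : Fintype.card ι + d ≤ Module.finrank Kᵐᵒᵖ ξ) :
    ∃ e : Fin d → n → K, (∀ i, e i ∈ ξ) ∧
      (∀ i j, star (e i) ⬝ᵥ e j = if i = j then 1 else 0) ∧
      ∀ i j, star (e₀ i) ⬝ᵥ e j = 0 := by
  induction d with
  | zero => exact ⟨Fin.elim0, fun i => i.elim0, fun i => i.elim0, fun _ i => i.elim0⟩
  | succ d ih =>
    obtain ⟨e, he1, he2, he3⟩ := ih (by omega)
    obtain ⟨v, hv1, hv2, hv3⟩ := exists_unit_orthogonal (Sum.elim e₀ e) ξ (by simp; omega)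
    refine ⟨Fin.snoc e v, fun i => ?_, fun i j => ?_, fun i j => ?_⟩
    · refine Fin.lastCases ?_ (fun i => ?_) i
      · simpa using hv1
      · simpa using he1 i
    · refine Fin.lastCases ?_ (fun i => ?_) i
      · refine Fin.lastCases ?_ (fun j => ?_) j
        · simpa using hv2
        · have := star_dotProduct_comm_zero (hv3 (Sum.inr j))
          simpa [(Fin.castSucc_lt_last j).ne'] using this
      · refine Fin.lastCases ?_ (fun j => ?_) j
        · simpa [(Fin.castSucc_lt_last i).ne] using hv3 (Sum.inr i)
        · simpa using he2 i j
    · refine Fin.lastCases ?_ (fun j => ?_) j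
      · simpa using hv3 (Sum.inl i)
      · simpa using he3 i j

end GramSchmidt

/-! ### The group action on the Grassmannian and the decomposition GL = U·P -/

section Grassmannian

variable {K : Type*} [NormedDivisionRing K] [NormedAlgebra ℝ K] [StarRing K] {r : ℕ}

theorem Gr.act_mul (g h : GL2r K r) (ξ : Gr K r) : Gr.act (g * h) ξ = Gr.act g (Gr.act h ξ) := by
  apply Subtype.ext
  change ξ.1.map _ = (ξ.1.map _).map _
  rw [← Submodule.map_comp]
  congr 1
  apply LinearMap.ext
  intro v
  change ((g * h : GL2r K r) : Matrix (Fin r ⊕ Fin r) (Fin r ⊕ Fin r) K) *ᵥ v =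
    (g : Matrix (Fin r ⊕ Fin r) (Fin r ⊕ Fin r) K) *ᵥ
      ((h : Matrix (Fin r ⊕ Fin r) (Fin r ⊕ Fin r) K) *ᵥ v)
  simp [Matrix.mulVec_mulVec]

theorem Gr.act_one (ξ : Gr K r) : Gr.act 1 ξ = ξ := by
  apply Subtype.ext
  change ξ.1.map _ = ξ.1
  convert Submodule.map_id ξ.1
  apply LinearMap.ext
  intro v
  change ((1 : GL2r K r) : Matrix (Fin r ⊕ Fin r) (Fin r ⊕ Fin r) K) *ᵥ v = v
  simp

/-- The first `r` columns of a matrix. -/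
def frame (g : GL2r K r) : Matrix (Fin r ⊕ Fin r) (Fin r) K :=
  (g : Matrix (Fin r ⊕ Fin r) (Fin r ⊕ Fin r) K).submatrix id Sum.inl

theorem frame_mul (g h : GL2r K r) :
    frame (g * h) = (g : Matrix (Fin r ⊕ Fin r) (Fin r ⊕ Fin r) K) * frame h := by
  ext i j
  simp [frame, Matrix.mul_apply]

theorem frame_mul_of_mem_parabolic (g : GL2r K r) {p : GL2r K r} (hp : p ∈ parabolic K r) :
    frame (g * p) = frame g * (p : Matrix (Fin r ⊕ Fin r) (Fin r ⊕ Fin r) K).toBlocks₁₁ := by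
  ext i j
  have h : ∀ k, (p : Matrix (Fin r ⊕ Fin r) (Fin r ⊕ Fin r) K) (Sum.inr k) (Sum.inl j) = 0 :=
    fun k => congrFun (congrFun hp k) j
  simp [frame, Matrix.mul_apply, h, Matrix.toBlocks₁₁]

theorem mulVec_elim_zero (g : GL2r K r) (a : Fin r → K) :
    (g : Matrix (Fin r ⊕ Fin r) (Fin r ⊕ Fin r) K) *ᵥ (Sum.elim a 0) = frame g *ᵥ a := by
  ext i
  simp [Matrix.mulVec, dotProduct, frame]

theorem Gr.mem_act_base {g : GL2r K r} {w : Fin r ⊕ Fin r → K} :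
    w ∈ (Gr.act g (Gr.base K r)).1 ↔ ∃ a : Fin r → K, frame g *ᵥ a = w := by
  constructor
  · rintro ⟨v, hv, rfl⟩
    refine ⟨v ∘ Sum.inl, ?_⟩
    rw [← mulVec_elim_zero]
    change _ = (g : Matrix (Fin r ⊕ Fin r) (Fin r ⊕ Fin r) K) *ᵥ v
    congr 1
    ext (i | i)
    · rfl
    · exact (congrFun hv i).symm
  · rintro ⟨a, rfl⟩
    refine ⟨Sum.elim a 0, ?_, mulVec_elim_zero g a⟩
    change sndProj (Sum.elim a 0) = 0
    ext i
    simp [sndProj, LinearMap.funLeft]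

theorem Gr.eq_of_le {ξ η : Gr K r} (h : ξ.1 ≤ η.1) : ξ = η :=
  Subtype.ext (Submodule.eq_of_le_of_finrank_eq h (by rw [ξ.2, η.2]))

theorem Gr.act_base_eq_base_iff {p : GL2r K r} :
    Gr.act p (Gr.base K r) = Gr.base K r ↔ p ∈ parabolic K r := by
  constructor
  · intro h
    ext i j
    have hmem : frame p *ᵥ (Pi.single j 1) ∈ (Gr.base K r).1 := by
      rw [← h]; exact Gr.mem_act_base.2 ⟨_, rfl⟩
    have := congrFun hmem i
    simpa [sndProj, LinearMap.funLeft, frame, Matrix.toBlocks₂₁] using this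
  · intro h
    apply Gr.eq_of_le
    intro w hw
    obtain ⟨a, rfl⟩ := Gr.mem_act_base.1 hw
    change sndProj _ = 0
    ext i
    have h : ∀ k, (p : Matrix (Fin r ⊕ Fin r) (Fin r ⊕ Fin r) K) (Sum.inr i) (Sum.inl k) = 0 :=
      fun k => congrFun (congrFun h i) k
    simp [sndProj, LinearMap.funLeft, frame, Matrix.mulVec, dotProduct, h]

theorem Gr.act_base_eq_iff {g h : GL2r K r} :
    Gr.act g (Gr.base K r) = Gr.act h (Gr.base K r) ↔ g⁻¹ * h ∈ parabolic K r := by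
  rw [← Gr.act_base_eq_base_iff, Gr.act_mul]
  constructor
  · intro hgh
    rw [← hgh, ← Gr.act_mul, inv_mul_cancel, Gr.act_one]
  · intro hgh
    have := congrArg (Gr.act g) hgh
    rwa [← Gr.act_mul, mul_inv_cancel, Gr.act_one, eq_comm] at this

/-- The unitary matrix has as columns an orthonormal basis of `ξ` followed by an orthonormal family
orthogonal to it. -/
theorem Gr.exists_unitary [IsHurwitz K] (ξ : Gr K r) :
    ∃ k : U2r K r, Gr.act (Unitary.toUnits k) (Gr.base K r) = ξ := by
  obtain ⟨e, he1, he2, -⟩ := exists_orthonormal_family (Fin.elim0 (α := Fin r ⊕ Fin r → K)) ξ.1 r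
    (by rw [ξ.2]; simp)
  obtain ⟨e', -, he2', he3'⟩ := exists_orthonormal_family e ⊤ r
    (by rw [finrank_top, finrank_pi_op]; simp)
  let k : Matrix (Fin r ⊕ Fin r) (Fin r ⊕ Fin r) K := Matrix.of fun i j => Sum.elim e e' j i
  have hk : star k * k = 1 := by
    have h : ∀ i j, (star k * k) i j = star (Sum.elim e e' i) ⬝ᵥ Sum.elim e e' j := fun i j => by
      simp [Matrix.mul_apply, dotProduct, k, Matrix.star_apply]
    ext i j
    rw [h]
    rcases i with i | i <;> rcases j with j | j
    · simp [he2, Matrix.one_apply]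
    · simp [he3']
    · simp [star_dotProduct_comm_zero (he3' j i)]
    · simp [he2', Matrix.one_apply]
  refine ⟨⟨k, Unitary.mem_iff.2 ⟨hk, mul_eq_one_comm.1 hk⟩⟩, Gr.eq_of_le fun w hw => ?_⟩
  obtain ⟨a, rfl⟩ := Gr.mem_act_base.1 hw
  have : frame (Unitary.toUnits (⟨k, Unitary.mem_iff.2 ⟨hk, mul_eq_one_comm.1 hk⟩⟩ : U2r K r)) *ᵥ a =
      ∑ j, MulOpposite.op (a j) • e j := by
    ext i
    simp [Matrix.mulVec, dotProduct, frame, k]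
  rw [this]
  exact Submodule.sum_mem _ fun j _ => ξ.1.smul_mem _ (he1 j)

/-- U is transitive on the Grassmannian and P is the stabilizer of the base point. -/
theorem exists_unitary_mul_parabolic [IsHurwitz K] (g : GL2r K r) :
    ∃ k : U2r K r, ∃ p ∈ parabolic K r, g = Unitary.toUnits k * p := by
  obtain ⟨k, hk⟩ := Gr.exists_unitary (Gr.act g (Gr.base K r))
  exact ⟨k, _, Gr.act_base_eq_iff.1 hk, by group⟩

theorem parabolic_eq_fromBlocks {p : GL2r K r} (hp : p ∈ parabolic K r) :
    (p : Matrix (Fin r ⊕ Fin r) (Fin r ⊕ Fin r) K) =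
      Matrix.fromBlocks (p : Matrix (Fin r ⊕ Fin r) (Fin r ⊕ Fin r) K).toBlocks₁₁
        (p : Matrix (Fin r ⊕ Fin r) (Fin r ⊕ Fin r) K).toBlocks₁₂ 0
        (p : Matrix (Fin r ⊕ Fin r) (Fin r ⊕ Fin r) K).toBlocks₂₂ := by
  conv_lhs => rw [← Matrix.fromBlocks_toBlocks (p : Matrix (Fin r ⊕ Fin r) (Fin r ⊕ Fin r) K)]
  rw [show (p : Matrix (Fin r ⊕ Fin r) (Fin r ⊕ Fin r) K).toBlocks₂₁ = 0 from hp]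

theorem frame_mulVec_injective (g : GL2r K r) {a : Fin r → K} (h : frame g *ᵥ a = 0) : a = 0 := by
  rw [← mulVec_elim_zero] at h
  have h2 := congrArg (fun v => (↑g⁻¹ : Matrix (Fin r ⊕ Fin r) (Fin r ⊕ Fin r) K) *ᵥ v) h
  simp only [Matrix.mulVec_mulVec, Units.inv_mul, Matrix.one_mulVec, Matrix.mulVec_zero] at h2
  ext i
  exact congrFun h2 (Sum.inl i)

theorem isUnit_toBlocks₁₁ {p : GL2r K r} (hp : p ∈ parabolic K r) :
    IsUnit (p : Matrix (Fin r ⊕ Fin r) (Fin r ⊕ Fin r) K).toBlocks₁₁ := by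
  apply isUnit_of_mulVec_injective
  intro v hv
  apply frame_mulVec_injective p
  have := frame_mul_of_mem_parabolic 1 hp
  rw [one_mul] at this
  rw [this, ← Matrix.mulVec_mulVec, hv, Matrix.mulVec_zero]

/-- Since B is invertible, p = diag(B, D) · [[1, B⁻¹C], [0, 1]]. -/
theorem detR_parabolic [IsHurwitz K] {p : GL2r K r} (hp : p ∈ parabolic K r) :
    detR (p : Matrix (Fin r ⊕ Fin r) (Fin r ⊕ Fin r) K) =
      detR (p : Matrix (Fin r ⊕ Fin r) (Fin r ⊕ Fin r) K).toBlocks₁₁ *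
        detR (p : Matrix (Fin r ⊕ Fin r) (Fin r ⊕ Fin r) K).toBlocks₂₂ := by
  have hB := isUnit_toBlocks₁₁ hp
  conv_lhs => rw [parabolic_eq_fromBlocks hp]
  set B := (p : Matrix (Fin r ⊕ Fin r) (Fin r ⊕ Fin r) K).toBlocks₁₁
  set C := (p : Matrix (Fin r ⊕ Fin r) (Fin r ⊕ Fin r) K).toBlocks₁₂
  set D := (p : Matrix (Fin r ⊕ Fin r) (Fin r ⊕ Fin r) K).toBlocks₂₂
  have : Matrix.fromBlocks B C 0 D =
      Matrix.fromBlocks B 0 0 D * Matrix.fromBlocks 1 (Ring.inverse B * C) 0 1 := by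
    simp [Matrix.fromBlocks_multiply, ← Matrix.mul_assoc, Ring.mul_inverse_cancel B hB]
  rw [this, detR_mul, detR_fromBlocks_diagonal, detR_fromBlocks_one_upper, mul_one]

theorem isUnit_toBlocks₂₂ [IsHurwitz K] {p : GL2r K r} (hp : p ∈ parabolic K r) :
    IsUnit (p : Matrix (Fin r ⊕ Fin r) (Fin r ⊕ Fin r) K).toBlocks₂₂ := by
  apply isUnit_of_detR_ne_zero
  have h := detR_ne_zero_of_isUnit p.isUnit
  rw [detR_parabolic hp] at h
  exact right_ne_zero_of_mul h

end Grassmannian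

/-! ### Induced functions and their compact picture -/

section Cocycle

variable {K : Type*} [NormedDivisionRing K] [NormedAlgebra ℝ K] [StarRing K] [IsHurwitz K] {r : ℕ}

/-- The extension of `p ↦ |det_ℝ (B D⁻¹)|` from the parabolic subgroup to the whole group that is
invariant under the unitary group. -/
def cocycle (g : GL2r K r) : ℝ :=
  |detR ((frame g)ᴴ * frame g)| / |detR (g : Matrix (Fin r ⊕ Fin r) (Fin r ⊕ Fin r) K)|

theorem isUnit_frame_gram (g : GL2r K r) : IsUnit ((frame g)ᴴ * frame g) := by
  apply isUnit_of_mulVec_injective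
  intro v hv
  apply frame_mulVec_injective g
  rw [← star_dotProduct_self_eq_zero]
  rw [Matrix.star_mulVec, ← Matrix.dotProduct_mulVec, Matrix.mulVec_mulVec, hv, dotProduct_zero]

theorem cocycle_pos (g : GL2r K r) : 0 < cocycle g :=
  div_pos (abs_pos.2 (detR_ne_zero_of_isUnit (isUnit_frame_gram g)))
    (abs_pos.2 (detR_ne_zero_of_isUnit g.isUnit))

/-- `|det_ℝ (B D⁻¹)|` for a block upper triangular matrix. -/
def realDelta (p : GL2r K r) : ℝ :=
  |detR ((p : Matrix (Fin r ⊕ Fin r) (Fin r ⊕ Fin r) K).toBlocks₁₁ *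
    Ring.inverse (p : Matrix (Fin r ⊕ Fin r) (Fin r ⊕ Fin r) K).toBlocks₂₂)|

theorem realDelta_eq {p : GL2r K r} (hp : p ∈ parabolic K r) :
    realDelta p = |detR (p : Matrix (Fin r ⊕ Fin r) (Fin r ⊕ Fin r) K).toBlocks₁₁| /
      |detR (p : Matrix (Fin r ⊕ Fin r) (Fin r ⊕ Fin r) K).toBlocks₂₂| := by
  rw [realDelta, detR_mul, detR_inverse (isUnit_toBlocks₂₂ hp), abs_mul, abs_inv, div_eq_mul_inv]

/-- The frame of g p is the frame of g times B, so the Gram matrix contributes |det B|², while |det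
(g p)| gains |det B| |det D|. -/
theorem cocycle_mul (g : GL2r K r) {p : GL2r K r} (hp : p ∈ parabolic K r) :
    cocycle (g * p) = realDelta p * cocycle g := by
  rw [realDelta_eq hp, cocycle, cocycle, frame_mul_of_mem_parabolic g hp, Matrix.conjTranspose_mul,
    Units.val_mul, detR_mul (g : Matrix (Fin r ⊕ Fin r) (Fin r ⊕ Fin r) K), detR_parabolic hp,
    Matrix.mul_assoc, detR_mul, detR_conjTranspose, ← Matrix.mul_assoc, detR_mul]
  have hB := abs_pos.2 (detR_ne_zero_of_isUnit (isUnit_toBlocks₁₁ hp))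
  have hD := abs_pos.2 (detR_ne_zero_of_isUnit (isUnit_toBlocks₂₂ hp))
  have hg := abs_pos.2 (detR_ne_zero_of_isUnit g.isUnit)
  simp only [abs_mul]
  field_simp

theorem frame_unitary_gram (k : U2r K r) :
    (frame (Unitary.toUnits k))ᴴ * frame (Unitary.toUnits k) = 1 := by
  have h := Unitary.coe_star_mul_self k
  ext i j
  have := congrFun (congrFun h (Sum.inl i)) (Sum.inl j)
  rw [Matrix.mul_apply] at this ⊢
  simpa [frame, Matrix.one_apply, Matrix.star_apply] using this

theorem cocycle_unitary (k : U2r K r) : cocycle (Unitary.toUnits k) = 1 := by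
  rw [cocycle, frame_unitary_gram, detR_one, Unitary.val_toUnits_apply, abs_detR_unitary k.2]
  simp

/-- The induced function with a given compact picture. -/
def inducedOf (s : ℂ) (f : Gr K r → ℂ) (g : GL2r K r) : ℂ :=
  ((cocycle g : ℂ) ^ (s + (r : ℂ) / 2))⁻¹ * f (Gr.act g (Gr.base K r))

theorem isInduced_inducedOf (s : ℂ) (f : Gr K r → ℂ) : IsInduced s (inducedOf s f) := by
  intro g p hp
  rw [inducedOf, inducedOf, cocycle_mul g hp, Gr.act_mul, Gr.act_base_eq_base_iff.2 hp,
    Complex.ofReal_mul, Complex.mul_cpow_ofReal_nonneg (show 0 ≤ realDelta p from abs_nonneg _)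
      (cocycle_pos g).le,
    mul_inv, mul_assoc]
  rfl

theorem hasCompactPicture_inducedOf (s : ℂ) (f : Gr K r → ℂ) :
    HasCompactPicture (inducedOf s f) f := by
  intro k
  rw [inducedOf, cocycle_unitary]
  simp

theorem IsInduced.ext {s : ℂ} {φ φ' : GL2r K r → ℂ} (h : IsInduced s φ) (h' : IsInduced s φ')
    (hk : ∀ k : U2r K r, φ (Unitary.toUnits k) = φ' (Unitary.toUnits k)) : φ = φ' := by
  ext g
  obtain ⟨k, p, hp, rfl⟩ := exists_unitary_mul_parabolic g
  rw [h _ _ hp, h' _ _ hp, hk]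

theorem IsInduced.eq_inducedOf {s : ℂ} {φ : GL2r K r → ℂ} {f : Gr K r → ℂ} (h : IsInduced s φ)
    (hf : HasCompactPicture φ f) : φ = inducedOf s f :=
  h.ext (isInduced_inducedOf s f) fun k => by rw [hf, hasCompactPicture_inducedOf s f]

theorem existsUnique_induced (s : ℂ) (f : Gr K r → ℂ) :
    ∃! φ : GL2r K r → ℂ, IsInduced s φ ∧ HasCompactPicture φ f :=
  ⟨inducedOf s f, ⟨isInduced_inducedOf s f, hasCompactPicture_inducedOf s f⟩,
    fun _ h => h.1.eq_inducedOf h.2⟩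

theorem existsUnique_compactPicture {s : ℂ} {φ : GL2r K r → ℂ} (hφ : IsInduced s φ) :
    ∃! f : Gr K r → ℂ, HasCompactPicture φ f := by
  choose k hk using Gr.exists_unitary (K := K) (r := r)
  refine ⟨fun ξ => φ (Unitary.toUnits (k ξ)), fun k' => ?_, fun f hf => ?_⟩
  · set k₀ := k (Gr.act (Unitary.toUnits k') (Gr.base K r)) with hk₀
    have hp := Gr.act_base_eq_iff.1 (hk (Gr.act (Unitary.toUnits k') (Gr.base K r)))
    rw [← hk₀] at hp
    -- The two unitary representatives of a point differ by an element of U ∩ P, on which the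
    -- character is trivial because `cocycle` is 1 on unitaries. Hence `f` does not depend on the
    -- chosen `k`.
    have h1 : realDelta ((Unitary.toUnits k₀)⁻¹ * Unitary.toUnits k') = 1 := by
      have h2 := cocycle_mul 1 hp
      rw [one_mul, ← map_inv, ← map_mul, cocycle_unitary, ← map_one (Unitary.toUnits),
        cocycle_unitary, mul_one] at h2
      rw [← map_inv, ← map_mul, ← h2]
    have h3 := hφ (Unitary.toUnits k₀) _ hp
    rw [mul_inv_cancel_left] at h3
    rw [h3]
    change (((realDelta _ : ℝ) : ℂ) ^ _)⁻¹ * _ = _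
    rw [h1, Complex.ofReal_one, Complex.one_cpow, inv_one, one_mul]
  · ext ξ
    rw [hf, hk]

end Cocycle

/-! ### Euclidean volumes and linear maps -/

section Volume

variable {K : Type*} [NormedDivisionRing K] [NormedAlgebra ℝ K] [StarRing K] [IsHurwitz K]
variable {m n : Type*} [Fintype m] [Fintype n] [DecidableEq m]

theorem sum_norm_sq_mulVec {V : Matrix n m K} (hV : Vᴴ * V = 1) (v : m → K) :
    ∑ i, ‖(V *ᵥ v) i‖ ^ 2 = ∑ i, ‖v i‖ ^ 2 := by
  apply (algebraMap ℝ K).injective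
  rw [← star_dotProduct_self, ← star_dotProduct_self, Matrix.star_mulVec,
    ← Matrix.dotProduct_mulVec, Matrix.mulVec_mulVec, hV, Matrix.one_mulVec]

/-- Hausdorff measure is intrinsic, so volumes inside a subspace of K^{2r} can be computed in
orthonormal coordinates on K^r. -/
theorem euclVol_image_of_isometry {V : Matrix n m K} (hV : Vᴴ * V = 1) (d : ℕ) (A : Set (m → K)) :
    euclVol d ((fun v => V *ᵥ v) '' A) = euclVol d A := by
  let mn : MeasurableSpace (PiLp 2 fun _ : n => K) := borel _
  have : BorelSpace (PiLp 2 fun _ : n => K) := ⟨rfl⟩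
  let mm : MeasurableSpace (PiLp 2 fun _ : m => K) := borel _
  have : BorelSpace (PiLp 2 fun _ : m => K) := ⟨rfl⟩
  let F : (PiLp 2 fun _ : m => K) → PiLp 2 fun _ : n => K :=
    fun v => WithLp.toLp 2 (V *ᵥ (WithLp.ofLp v))
  have hF : Isometry F := by
    apply Isometry.of_dist_eq
    intro x y
    rw [dist_eq_norm, dist_eq_norm, PiLp.norm_eq_of_L2, PiLp.norm_eq_of_L2,
      ← sum_norm_sq_mulVec hV]
    congr 2
    ext i
    simp [F, Matrix.mulVec_sub]
  change Measure.hausdorffMeasure (d : ℝ) _ = Measure.hausdorffMeasure (d : ℝ) _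
  rw [← hF.hausdorffMeasure_image (Or.inl (Nat.cast_nonneg d)), Set.image_image, Set.image_image]

theorem unitary_conjTranspose_mul {V : Matrix n n K} [DecidableEq n]
    (hV : V ∈ unitary (Matrix n n K)) : Vᴴ * V = 1 := Unitary.star_mul_self_of_mem hV

/-- The unit ball of the Euclidean space `K^m`. -/
def euclBall (K m : Type*) [NormedDivisionRing K] [Fintype m] : Set (m → K) :=
  {v | ∑ i, ‖v i‖ ^ 2 ≤ 1}

/-- In the top dimension, Hausdorff measure is a Haar measure and scales by the determinant. -/
theorem euclVol_image_mulVec (C : Matrix m m K) (A : Set (m → K)) :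
    euclVol (Module.finrank ℝ K * Fintype.card m) ((fun v => C *ᵥ v) '' A) =
      ENNReal.ofReal |detR C| * euclVol (Module.finrank ℝ K * Fintype.card m) A := by
  let mm : MeasurableSpace (PiLp 2 fun _ : m => K) := borel _
  have : BorelSpace (PiLp 2 fun _ : m => K) := ⟨rfl⟩
  have hd : Module.finrank ℝ K * Fintype.card m = Module.finrank ℝ (PiLp 2 fun _ : m => K) := by
    rw [(WithLp.linearEquiv 2 ℝ (m → K)).finrank_eq, Module.finrank_pi_fintype]
    simp [mul_comm]
  let e : (m → K) ≃ₗ[ℝ] (PiLp 2 fun _ : m => K) := (WithLp.linearEquiv 2 ℝ (m → K)).symm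
  rw [hd]
  change Measure.hausdorffMeasure (Module.finrank ℝ (PiLp 2 fun _ : m => K) : ℝ) _ =
    _ * Measure.hausdorffMeasure (Module.finrank ℝ (PiLp 2 fun _ : m => K) : ℝ) _
  rw [detR, ← LinearMap.det_conj (mulVecR C) e, ← Measure.addHaar_image_linearMap,
    Set.image_image, Set.image_image]
  rfl

theorem euclVol_euclBall :
    euclVol (Module.finrank ℝ K * Fintype.card m) (euclBall K m) ≠ 0 ∧
      euclVol (Module.finrank ℝ K * Fintype.card m) (euclBall K m) ≠ ⊤ := by
  let mm : MeasurableSpace (PiLp 2 fun _ : m => K) := borel _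
  have : BorelSpace (PiLp 2 fun _ : m => K) := ⟨rfl⟩
  have hd : Module.finrank ℝ K * Fintype.card m = Module.finrank ℝ (PiLp 2 fun _ : m => K) := by
    rw [(WithLp.linearEquiv 2 ℝ (m → K)).finrank_eq, Module.finrank_pi_fintype]
    simp [mul_comm]
  have : ProperSpace (PiLp 2 fun _ : m => K) := FiniteDimensional.proper ℝ _
  have hB : (WithLp.toLp 2 : (m → K) → PiLp 2 fun _ : m => K) '' (euclBall K m) =
      Metric.closedBall 0 1 := by
    ext v
    rw [mem_closedBall_zero_iff, PiLp.norm_eq_of_L2, Real.sqrt_le_iff, one_pow, and_iff_right zero_le_one]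
    constructor
    · rintro ⟨w, hw, rfl⟩
      exact hw
    · intro h
      exact ⟨WithLp.ofLp v, h, rfl⟩
  rw [hd]
  change Measure.hausdorffMeasure (Module.finrank ℝ (PiLp 2 fun _ : m => K) : ℝ) _ ≠ 0 ∧
    Measure.hausdorffMeasure (Module.finrank ℝ (PiLp 2 fun _ : m => K) : ℝ) _ ≠ ⊤
  rw [hB]
  exact ⟨(Metric.measure_closedBall_pos _ _ one_pos).ne', measure_closedBall_lt_top.ne⟩

/-- A contraction maps the unit ball into itself, so it cannot increase its volume, which is finite
and nonzero. -/
theorem abs_detR_le_one {C : Matrix m m K}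
    (hC : ∀ v, ∑ i, ‖(C *ᵥ v) i‖ ^ 2 ≤ ∑ i, ‖v i‖ ^ 2) : |detR C| ≤ 1 := by
  have h1 : (fun v => C *ᵥ v) '' euclBall K m ⊆ euclBall K m := by
    rintro _ ⟨v, hv, rfl⟩
    exact (hC v).trans hv
  have h2 := euclVol_image_mulVec C (euclBall K m)
  have h3 : euclVol (Module.finrank ℝ K * Fintype.card m) ((fun v => C *ᵥ v) '' euclBall K m) ≤
      euclVol (Module.finrank ℝ K * Fintype.card m) (euclBall K m) :=
    measure_mono (Set.image_mono h1)
  rw [h2] at h3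
  obtain ⟨h4, h5⟩ := euclVol_euclBall (K := K) (m := m)
  have h6 : ENNReal.ofReal |detR C| ≤ 1 := by
    by_contra h
    push Not at h
    have := ENNReal.mul_lt_mul_left h4 h5 h
    rw [one_mul] at this
    exact absurd h3 (not_le.2 this)
  simpa using h6

end Volume

/-! ### The sine as a determinant, and its form in the chart -/

section SinAngle

variable {K : Type*} [NormedDivisionRing K] [NormedAlgebra ℝ K] [StarRing K] [IsHurwitz K] {r : ℕ}

/-- The last `r` columns of a matrix. -/
def coframe (g : GL2r K r) : Matrix (Fin r ⊕ Fin r) (Fin r) K :=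
  (g : Matrix (Fin r ⊕ Fin r) (Fin r ⊕ Fin r) K).submatrix id Sum.inr

theorem coframe_unitary_gram (k : U2r K r) :
    (coframe (Unitary.toUnits k))ᴴ * coframe (Unitary.toUnits k) = 1 := by
  have h := Unitary.coe_star_mul_self k
  ext i j
  have := congrFun (congrFun h (Sum.inr i)) (Sum.inr j)
  rw [Matrix.mul_apply] at this ⊢
  simpa [coframe, Matrix.one_apply, Matrix.star_apply] using this

theorem frame_conjTranspose_mul_coframe (k : U2r K r) :
    (frame (Unitary.toUnits k))ᴴ * coframe (Unitary.toUnits k) = 0 := by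
  have h := Unitary.coe_star_mul_self k
  ext i j
  have := congrFun (congrFun h (Sum.inl i)) (Sum.inr j)
  rw [Matrix.mul_apply] at this ⊢
  simpa [frame, coframe, Matrix.one_apply, Matrix.star_apply] using this

theorem frame_add_coframe (k : U2r K r) :
    frame (Unitary.toUnits k) * (frame (Unitary.toUnits k))ᴴ +
      coframe (Unitary.toUnits k) * (coframe (Unitary.toUnits k))ᴴ = 1 := by
  have h := Unitary.coe_mul_star_self k
  rw [← h]
  ext i j
  simp [frame, coframe, Matrix.mul_apply, Matrix.star_apply]

theorem mem_perp_act_base {k : U2r K r} {w : Fin r ⊕ Fin r → K} :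
    w ∈ perp (Gr.act (Unitary.toUnits k) (Gr.base K r)).1 ↔
      ∃ u : Fin r → K, coframe (Unitary.toUnits k) *ᵥ u = w := by
  constructor
  · intro h
    have h0 : (frame (Unitary.toUnits k))ᴴ *ᵥ w = 0 := by
      rw [← star_dotProduct_self_eq_zero]
      have := h _ (Gr.mem_act_base.2 ⟨(frame (Unitary.toUnits k))ᴴ *ᵥ w, rfl⟩)
      rwa [Matrix.star_mulVec, ← Matrix.dotProduct_mulVec] at this
    refine ⟨(coframe (Unitary.toUnits k))ᴴ *ᵥ w, ?_⟩
    have h1 := congrArg (fun A => A *ᵥ w) (frame_add_coframe k)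
    simpa only [Matrix.add_mulVec, ← Matrix.mulVec_mulVec, h0, Matrix.mulVec_zero, zero_add,
      Matrix.one_mulVec] using h1
  · rintro ⟨u, rfl⟩ x hx
    obtain ⟨a, rfl⟩ := Gr.mem_act_base.1 hx
    rw [Matrix.star_mulVec, ← Matrix.dotProduct_mulVec, Matrix.mulVec_mulVec,
      frame_conjTranspose_mul_coframe, Matrix.zero_mulVec, dotProduct_zero]

theorem toBlocks₂₁_eq (k₁ k₂ : U2r K r) :
    ((star k₂ * k₁ : U2r K r) : Matrix (Fin r ⊕ Fin r) (Fin r ⊕ Fin r) K).toBlocks₂₁ =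
      (coframe (Unitary.toUnits k₂))ᴴ * frame (Unitary.toUnits k₁) := by
  ext i j
  simp [frame, coframe, Matrix.mul_apply, Matrix.toBlocks₂₁, Matrix.star_apply]

theorem unitBall_act_base (k : U2r K r) :
    unitBall (Gr.act (Unitary.toUnits k) (Gr.base K r)).1 =
      (fun v => frame (Unitary.toUnits k) *ᵥ v) '' euclBall K (Fin r) := by
  ext w
  constructor
  · rintro ⟨hw, hw1⟩
    obtain ⟨a, rfl⟩ := Gr.mem_act_base.1 hw
    rw [sum_norm_sq_mulVec (frame_unitary_gram k)] at hw1
    exact ⟨a, hw1, rfl⟩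
  · rintro ⟨a, ha, rfl⟩
    refine ⟨Gr.mem_act_base.2 ⟨a, rfl⟩, ?_⟩
    rw [sum_norm_sq_mulVec (frame_unitary_gram k)]
    exact ha

/-- Writing Q for the last r columns of `k₂`, the orthogonal projection onto the complement is Q Q*,
and Q* times the first r columns of `k₁` is the lower left block of `star k₂ * k₁`. -/
theorem projImage_perp_act_base (k₁ k₂ : U2r K r) (B : Set (Fin r → K)) :
    projImage (perp (Gr.act (Unitary.toUnits k₂) (Gr.base K r)).1)
        ((fun v => frame (Unitary.toUnits k₁) *ᵥ v) '' B) =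
      (fun v => coframe (Unitary.toUnits k₂) *ᵥ v) '' ((fun v =>
        ((star k₂ * k₁ : U2r K r) : Matrix (Fin r ⊕ Fin r) (Fin r ⊕ Fin r) K).toBlocks₂₁ *ᵥ v) ''
          B) := by
  rw [Set.image_image]
  have hgram := coframe_unitary_gram k₂
  ext w
  simp only [toBlocks₂₁_eq, ← Matrix.mulVec_mulVec]
  constructor
  · rintro ⟨hw, _, ⟨v, hv, rfl⟩, hvw⟩
    refine ⟨v, hv, ?_⟩
    obtain ⟨u, rfl⟩ := mem_perp_act_base.1 hw
    have h0 : (coframe (Unitary.toUnits k₂))ᴴ *ᵥ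
        (frame (Unitary.toUnits k₁) *ᵥ v - coframe (Unitary.toUnits k₂) *ᵥ u) = 0 := by
      rw [← star_dotProduct_self_eq_zero]
      have := hvw _ (mem_perp_act_base.2 ⟨(coframe (Unitary.toUnits k₂))ᴴ *ᵥ
        (frame (Unitary.toUnits k₁) *ᵥ v - coframe (Unitary.toUnits k₂) *ᵥ u), rfl⟩)
      rwa [Matrix.star_mulVec, ← Matrix.dotProduct_mulVec] at this
    rw [Matrix.mulVec_sub, Matrix.mulVec_mulVec _ _ (coframe (Unitary.toUnits k₂)), hgram,
      Matrix.one_mulVec, sub_eq_zero] at h0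
    simp only [h0]
  · rintro ⟨v, hv, rfl⟩
    refine ⟨mem_perp_act_base.2 ⟨_, rfl⟩, _, ⟨v, hv, rfl⟩, ?_⟩
    intro y hy
    obtain ⟨u, rfl⟩ := mem_perp_act_base.1 hy
    rw [Matrix.star_mulVec, ← Matrix.dotProduct_mulVec, Matrix.mulVec_sub,
      Matrix.mulVec_mulVec _ _ (coframe (Unitary.toUnits k₂)), hgram, Matrix.one_mulVec, sub_self,
      dotProduct_zero]

/-- The frame and coframe are isometric embeddings, so both volumes reduce to K^r and their quotient
is the factor by which the block scales volume. -/
theorem sinAngle_unitary (k₁ k₂ : U2r K r) :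
    sinAngle (Gr.act (Unitary.toUnits k₁) (Gr.base K r)).1
        (Gr.act (Unitary.toUnits k₂) (Gr.base K r)).1 =
      |detR ((star k₂ * k₁ : U2r K r) :
        Matrix (Fin r ⊕ Fin r) (Fin r ⊕ Fin r) K).toBlocks₂₁| ^
          ((1 : ℝ) / Module.finrank ℝ K) := by
  obtain ⟨h4, h5⟩ := euclVol_euclBall (K := K) (m := Fin r)
  have h6 := euclVol_image_mulVec
    ((star k₂ * k₁ : U2r K r) : Matrix (Fin r ⊕ Fin r) (Fin r ⊕ Fin r) K).toBlocks₂₁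
    (euclBall K (Fin r))
  rw [sinAngle, cosAngle, (Gr.act (Unitary.toUnits k₁) (Gr.base K r)).2, unitBall_act_base,
    projImage_perp_act_base, euclVol_image_of_isometry (coframe_unitary_gram k₂),
    euclVol_image_of_isometry (frame_unitary_gram k₁)]
  rw [Fintype.card_fin] at h4 h5 h6
  rw [h6, ENNReal.mul_div_cancel_right h4 h5, ENNReal.toReal_ofReal (abs_nonneg _)]

/-- A block of a unitary matrix is a contraction. -/
theorem abs_detR_toBlocks₂₁_le_one (k : U2r K r) :
    |detR (k : Matrix (Fin r ⊕ Fin r) (Fin r ⊕ Fin r) K).toBlocks₂₁| ≤ 1 := by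
  apply abs_detR_le_one
  intro v
  rw [← sum_norm_sq_mulVec (frame_unitary_gram k) v, Fintype.sum_sum_type]
  refine le_add_of_nonneg_of_le (Finset.sum_nonneg fun i _ => by positivity) (le_of_eq ?_)
  rfl

theorem sinAngle_nonneg (ξ η : Gr K r) : 0 ≤ sinAngle ξ.1 η.1 :=
  Real.rpow_nonneg ENNReal.toReal_nonneg _

theorem sinAngle_le_one (ξ η : Gr K r) : sinAngle ξ.1 η.1 ≤ 1 := by
  obtain ⟨k₁, rfl⟩ := Gr.exists_unitary ξ
  obtain ⟨k₂, rfl⟩ := Gr.exists_unitary η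
  rw [sinAngle_unitary]
  exact Real.rpow_le_one (abs_nonneg _) (abs_detR_toBlocks₂₁_le_one _) (by positivity)

/-- The factor by which `[I; Y]` scales real volumes; it is `|det_ℝ B|` for every decomposition
`[[I, 0], [Y, I]] = k [[B, C], [0, D]]` with `k` unitary. -/
def weight (Y : Matrix (Fin r) (Fin r) K) : ℝ := √(cocycle (nbar Y))

theorem weight_pos (Y : Matrix (Fin r) (Fin r) K) : 0 < weight Y :=
  Real.sqrt_pos.2 (cocycle_pos _)

/-- Since det_ℝ n̄_Y = 1, |det B| |det D| = 1, while |det B| / |det D| is the cocycle of n̄_Y, which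
is the square of the weight. -/
theorem exists_nbar_eq (Y : Matrix (Fin r) (Fin r) K) :
    ∃ k : U2r K r, ∃ p ∈ parabolic K r, nbar Y = Unitary.toUnits k * p ∧
      |detR (p : Matrix (Fin r ⊕ Fin r) (Fin r ⊕ Fin r) K).toBlocks₁₁| = weight Y ∧
      |detR (p : Matrix (Fin r ⊕ Fin r) (Fin r ⊕ Fin r) K).toBlocks₂₂| = (weight Y)⁻¹ := by
  obtain ⟨k, p, hp, h⟩ := exists_unitary_mul_parabolic (nbar Y)
  have h1 : cocycle (nbar Y) = realDelta p := by
    rw [h, cocycle_mul _ hp, cocycle_unitary, mul_one]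
  have h2 : |detR ((nbar Y : GL2r K r) : Matrix (Fin r ⊕ Fin r) (Fin r ⊕ Fin r) K)| = 1 := by
    change |detR (Matrix.fromBlocks 1 0 Y 1)| = 1
    rw [detR_fromBlocks_one_lower, abs_one]
  rw [h, Units.val_mul, detR_mul, abs_mul, Unitary.val_toUnits_apply, abs_detR_unitary k.2, one_mul,
    detR_parabolic hp, abs_mul] at h2
  rw [realDelta_eq hp] at h1
  have hD : |detR (p : Matrix (Fin r ⊕ Fin r) (Fin r ⊕ Fin r) K).toBlocks₂₂| =
      (|detR (p : Matrix (Fin r ⊕ Fin r) (Fin r ⊕ Fin r) K).toBlocks₁₁|)⁻¹ :=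
    eq_inv_of_mul_eq_one_right h2
  have hB : |detR (p : Matrix (Fin r ⊕ Fin r) (Fin r ⊕ Fin r) K).toBlocks₁₁| = weight Y := by
    rw [weight, h1, hD, div_inv_eq_mul, Real.sqrt_mul_self (abs_nonneg _)]
  exact ⟨k, p, hp, h, hB, by rw [hD, hB]⟩

theorem cocycle_nbar (Y : Matrix (Fin r) (Fin r) K) : cocycle (nbar Y) = weight Y ^ 2 := by
  rw [weight, Real.sq_sqrt (cocycle_pos _).le]

/-- Write n̄_X = k₁p₁ and n̄_Y = k₂p₂. From n̄_Y⁻¹ n̄_X = n̄_{X-Y} one gets k₂*k₁ p₁ = p₂ n̄_{X-Y};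
comparing lower left blocks gives (k₂*k₁)₂₁ B₁ = D₂ (X - Y), with |det B₁| = w(X) and |det D₂| =
w(Y)⁻¹. -/
theorem sinAngle_nbar (X Y : Matrix (Fin r) (Fin r) K) :
    sinAngle (Gr.act (nbar X) (Gr.base K r)).1 (Gr.act (nbar Y) (Gr.base K r)).1 =
      (|detR (X - Y)| * (weight X)⁻¹ * (weight Y)⁻¹) ^ ((1 : ℝ) / Module.finrank ℝ K) := by
  obtain ⟨k₁, p₁, hp₁, h₁, hB₁, hD₁⟩ := exists_nbar_eq X
  obtain ⟨k₂, p₂, hp₂, h₂, hB₂, hD₂⟩ := exists_nbar_eq Y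
  have hk : (Unitary.toUnits (star k₂ * k₁) : GL2r K r) * p₁ = p₂ * nbar (X - Y) := by
    have h3 : nbar (X - Y) = (nbar Y)⁻¹ * nbar X := by
      apply Units.ext
      change Matrix.fromBlocks 1 0 (X - Y) 1 =
        Matrix.fromBlocks 1 0 (-Y) 1 * Matrix.fromBlocks 1 0 X 1
      simp [Matrix.fromBlocks_multiply, sub_eq_neg_add]
    have h4 : star k₂ = k₂⁻¹ := rfl
    rw [h3, h₁, h₂, h4, map_mul, map_inv]
    group
  have hk' := congrArg (fun g : GL2r K r =>
    (g : Matrix (Fin r ⊕ Fin r) (Fin r ⊕ Fin r) K).toBlocks₂₁) hk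
  simp only [Units.val_mul, Unitary.val_toUnits_apply] at hk'
  have e1 : (((star k₂ * k₁ : U2r K r) : Matrix (Fin r ⊕ Fin r) (Fin r ⊕ Fin r) K) *
      (p₁ : Matrix (Fin r ⊕ Fin r) (Fin r ⊕ Fin r) K)).toBlocks₂₁ =
      ((star k₂ * k₁ : U2r K r) : Matrix (Fin r ⊕ Fin r) (Fin r ⊕ Fin r) K).toBlocks₂₁ *
        (p₁ : Matrix (Fin r ⊕ Fin r) (Fin r ⊕ Fin r) K).toBlocks₁₁ := by
    rw [parabolic_eq_fromBlocks hp₁]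
    conv_lhs => rw [← Matrix.fromBlocks_toBlocks
      ((star k₂ * k₁ : U2r K r) : Matrix (Fin r ⊕ Fin r) (Fin r ⊕ Fin r) K)]
    rw [Matrix.fromBlocks_multiply]
    simp
  have e2 : ((p₂ : Matrix (Fin r ⊕ Fin r) (Fin r ⊕ Fin r) K) *
      (nbar (X - Y) : GL2r K r)).toBlocks₂₁ =
      (p₂ : Matrix (Fin r ⊕ Fin r) (Fin r ⊕ Fin r) K).toBlocks₂₂ * (X - Y) := by
    rw [parabolic_eq_fromBlocks hp₂]
    rw [show ((nbar (X - Y) : GL2r K r) : Matrix (Fin r ⊕ Fin r) (Fin r ⊕ Fin r) K) =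
      Matrix.fromBlocks 1 0 (X - Y) 1 from rfl, Matrix.fromBlocks_multiply]
    simp
  rw [e1, e2] at hk'
  have hd := congrArg (fun A => |detR A|) hk'
  simp only [detR_mul, abs_mul] at hd
  rw [hB₁, hD₂] at hd
  have e3 : Gr.act (nbar X) (Gr.base K r) = Gr.act (Unitary.toUnits k₁) (Gr.base K r) := by
    rw [h₁, Gr.act_mul, Gr.act_base_eq_base_iff.2 hp₁]
  have e4 : Gr.act (nbar Y) (Gr.base K r) = Gr.act (Unitary.toUnits k₂) (Gr.base K r) := by
    rw [h₂, Gr.act_mul, Gr.act_base_eq_base_iff.2 hp₂]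
  rw [e3, e4, sinAngle_unitary]
  congr 1
  have := weight_pos X
  rw [eq_comm, mul_right_comm, mul_inv_eq_iff_eq_mul₀ this.ne', hd, mul_comm]

end SinAngle

/-! ### Topology of matrices and compactness of the unitary group -/

section MatrixTopology

variable {K : Type*} [NormedDivisionRing K] [NormedAlgebra ℝ K] [StarRing K] [IsHurwitz K]
variable {m n : Type*} [Fintype m] [Fintype n] [DecidableEq m]

instance : SecondCountableTopology K := secondCountable_of_proper

instance : SecondCountableTopology (Matrix m n K) :=
  inferInstanceAs (SecondCountableTopology (m → n → K))

theorem continuousAt_matrix_inverse {A : Matrix m m K} (hA : IsUnit A) :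
    ContinuousAt (Ring.inverse : Matrix m m K → Matrix m m K) A := by
  let _ : NormedRing (Matrix m m K) := Matrix.linftyOpNormedRing
  let _ : NormedAlgebra ℝ (Matrix m m K) := Matrix.linftyOpNormedAlgebra
  have : CompleteSpace (Matrix m m K) := FiniteDimensional.complete ℝ _
  obtain ⟨u, rfl⟩ := hA
  exact NormedRing.inverse_continuousAt u

theorem isOpen_setOf_isUnit : IsOpen {A : Matrix m m K | IsUnit A} := by
  simp only [isUnit_iff_detR_ne_zero]
  exact isOpen_ne_fun continuous_detR continuous_const

theorem measurable_matrix_inverse [MeasurableSpace (Matrix m m K)] [BorelSpace (Matrix m m K)] :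
    Measurable (Ring.inverse : Matrix m m K → Matrix m m K) := by
  classical
  -- `Ring.inverse` is continuous on the open set of units and takes the default value 0 elsewhere.
  have h : (Ring.inverse : Matrix m m K → Matrix m m K) =
      {A : Matrix m m K | IsUnit A}.piecewise Ring.inverse (fun _ => 0) := by
    ext1 A
    by_cases hA : IsUnit A
    · simp [Set.piecewise, hA]
    · simp [Set.piecewise, hA]
  rw [h]
  apply ContinuousOn.measurable_piecewise
  · exact fun A hA => (continuousAt_matrix_inverse hA).continuousWithinAt
  · exact continuousOn_const
  · exact isOpen_setOf_isUnit.measurableSet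

theorem norm_entry_le_one_of_unitary {k : Matrix m m K} (hk : k ∈ unitary (Matrix m m K))
    (i j : m) : ‖k i j‖ ≤ 1 := by
  have h := sum_norm_sq_mulVec (unitary_conjTranspose_mul hk) (Pi.single j 1)
  have h1 : ∑ i, ‖(Pi.single j 1 : m → K) i‖ ^ 2 = 1 := by
    rw [Finset.sum_eq_single j] <;> simp +contextual
  rw [h1] at h
  have h2 := Finset.single_le_sum (f := fun i => ‖(k *ᵥ Pi.single j 1) i‖ ^ 2)
    (fun i _ => by positivity) (Finset.mem_univ i)
  rw [h] at h2
  simpa using h2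

instance : CompactSpace (unitary (Matrix m m K)) := by
  apply (isCompact_iff_compactSpace (s := (unitary (Matrix m m K) : Set (Matrix m m K)))).1
  have hc : IsCompact (Set.univ.pi fun _ : m => Set.univ.pi fun _ : m =>
      Metric.closedBall (0 : K) 1) :=
    isCompact_univ_pi fun _ => isCompact_univ_pi fun _ => isCompact_closedBall _ _
  refine IsCompact.of_isClosed_subset (X := Matrix m m K) hc isClosed_unitary ?_
  intro k hk i _ j _
  simpa using norm_entry_le_one_of_unitary hk i j

end MatrixTopology

/-! ### Topology of the Grassmannian through orthogonal projections -/

section GrTopology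

variable {K : Type*} [NormedDivisionRing K] [NormedAlgebra ℝ K] [StarRing K] [IsHurwitz K] {r : ℕ}

/-- The matrix of the orthogonal projection onto the span of the first `r` columns. -/
def projMat (g : GL2r K r) : Matrix (Fin r ⊕ Fin r) (Fin r ⊕ Fin r) K :=
  frame g * Ring.inverse ((frame g)ᴴ * frame g) * (frame g)ᴴ

theorem projMat_mul_of_mem_parabolic (g : GL2r K r) {p : GL2r K r} (hp : p ∈ parabolic K r) :
    projMat (g * p) = projMat g := by
  obtain ⟨u, hu⟩ := isUnit_toBlocks₁₁ hp
  obtain ⟨v, hv⟩ := isUnit_frame_gram g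
  have h : ((frame g * (u : Matrix (Fin r) (Fin r) K))ᴴ *
      (frame g * (u : Matrix (Fin r) (Fin r) K))) = ((star u * v * u :
        (Matrix (Fin r) (Fin r) K)ˣ) : Matrix (Fin r) (Fin r) K) := by
    simp only [Units.val_mul, hv, Units.coe_star, Matrix.conjTranspose_mul, Matrix.mul_assoc,
      Matrix.star_eq_conjTranspose]
  rw [projMat, projMat, frame_mul_of_mem_parabolic g hp, ← hu, h, ← hv, Ring.inverse_unit,
    Ring.inverse_unit, mul_inv_rev, mul_inv_rev, Units.val_mul, Units.val_mul,
    Matrix.conjTranspose_mul, ← Matrix.star_eq_conjTranspose (u : Matrix (Fin r) (Fin r) K),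
    ← Units.coe_star]
  simp only [Matrix.mul_assoc]
  rw [← Matrix.mul_assoc (↑(star u)⁻¹ : Matrix (Fin r) (Fin r) K), Units.inv_mul, Matrix.one_mul,
    ← Matrix.mul_assoc (u : Matrix (Fin r) (Fin r) K), Units.mul_inv, Matrix.one_mul]

theorem projMat_mul_frame (g : GL2r K r) : projMat g * frame g = frame g := by
  rw [projMat, Matrix.mul_assoc, Matrix.mul_assoc, Ring.inverse_mul_cancel _ (isUnit_frame_gram g),
    Matrix.mul_one]

theorem projMat_unitary (k : U2r K r) : projMat (Unitary.toUnits k) =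
    frame (Unitary.toUnits k) * (frame (Unitary.toUnits k))ᴴ := by
  rw [projMat, frame_unitary_gram, Ring.inverse_one, Matrix.mul_one]

theorem projMat_unitary_mul (k : U2r K r) (g : GL2r K r) : projMat (Unitary.toUnits k * g) =
    (k : Matrix (Fin r ⊕ Fin r) (Fin r ⊕ Fin r) K) * projMat g *
      star (k : Matrix (Fin r ⊕ Fin r) (Fin r ⊕ Fin r) K) := by
  have h : (frame (Unitary.toUnits k * g))ᴴ * frame (Unitary.toUnits k * g) =
      (frame g)ᴴ * frame g := by
    rw [frame_mul, Matrix.conjTranspose_mul, Matrix.mul_assoc, ← Matrix.mul_assoc _ _ (frame g),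
      Unitary.val_toUnits_apply, unitary_conjTranspose_mul k.2, Matrix.one_mul]
  rw [projMat, h, frame_mul, Matrix.conjTranspose_mul, Unitary.val_toUnits_apply, projMat,
    Matrix.star_eq_conjTranspose]
  simp only [Matrix.mul_assoc]

/-- The orthogonal projection onto a point of the Grassmannian, as a matrix. -/
def Gr.proj (ξ : Gr K r) : Matrix (Fin r ⊕ Fin r) (Fin r ⊕ Fin r) K :=
  projMat (Unitary.toUnits (Gr.exists_unitary ξ).choose)

theorem Gr.proj_act_base (g : GL2r K r) : Gr.proj (Gr.act g (Gr.base K r)) = projMat g := by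
  have h := (Gr.exists_unitary (Gr.act g (Gr.base K r))).choose_spec
  rw [Gr.proj, ← projMat_mul_of_mem_parabolic _ (Gr.act_base_eq_iff.1 h), mul_inv_cancel_left]

theorem Gr.proj_act_unitary (k : U2r K r) (ξ : Gr K r) : Gr.proj (Gr.act (Unitary.toUnits k) ξ) =
    (k : Matrix (Fin r ⊕ Fin r) (Fin r ⊕ Fin r) K) * Gr.proj ξ *
      star (k : Matrix (Fin r ⊕ Fin r) (Fin r ⊕ Fin r) K) := by
  obtain ⟨k', rfl⟩ := Gr.exists_unitary ξ
  rw [← Gr.act_mul, Gr.proj_act_base, Gr.proj_act_base, projMat_unitary_mul]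

/-- A subspace is the range of its projection. With compactness this makes the Grassmannian a closed
subspace of a matrix space, hence Hausdorff and second countable. -/
theorem Gr.proj_injective : Function.Injective (Gr.proj : Gr K r → _) := by
  intro ξ η h
  obtain ⟨k, rfl⟩ := Gr.exists_unitary ξ
  obtain ⟨k', rfl⟩ := Gr.exists_unitary η
  rw [Gr.proj_act_base, Gr.proj_act_base] at h
  apply Gr.eq_of_le
  intro w hw
  obtain ⟨a, rfl⟩ := Gr.mem_act_base.1 hw
  refine Gr.mem_act_base.2 ⟨((frame (Unitary.toUnits k'))ᴴ * frame (Unitary.toUnits k)) *ᵥ a, ?_⟩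
  rw [Matrix.mulVec_mulVec, ← Matrix.mul_assoc, ← projMat_unitary, ← h, projMat_mul_frame]

theorem Gr.isQuotientMap_orbit :
    Topology.IsQuotientMap fun k : U2r K r => Gr.act (Unitary.toUnits k) (Gr.base K r) :=
  ⟨⟨rfl⟩, Gr.exists_unitary⟩

theorem Gr.continuous_proj : Continuous (Gr.proj : Gr K r → _) := by
  rw [Gr.isQuotientMap_orbit.continuous_iff]
  have : (Gr.proj ∘ fun k : U2r K r => Gr.act (Unitary.toUnits k) (Gr.base K r)) = fun k : U2r K r =>
      (k : Matrix (Fin r ⊕ Fin r) (Fin r ⊕ Fin r) K).submatrix id Sum.inl *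
        ((k : Matrix (Fin r ⊕ Fin r) (Fin r ⊕ Fin r) K).submatrix id Sum.inl)ᴴ := by
    ext1 k
    rw [Function.comp_apply, Gr.proj_act_base, projMat_unitary]
    rfl
  rw [this]
  have h : Continuous fun k : U2r K r =>
      (k : Matrix (Fin r ⊕ Fin r) (Fin r ⊕ Fin r) K).submatrix id (Sum.inl : Fin r → _) :=
    continuous_subtype_val.matrix_submatrix _ _
  exact h.matrix_mul h.matrix_conjTranspose

instance : CompactSpace (Gr K r) := Gr.isQuotientMap_orbit.surjective.compactSpace
  Gr.isQuotientMap_orbit.continuous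

instance : T2Space (Gr K r) := T2Space.of_injective_continuous Gr.proj_injective Gr.continuous_proj

theorem Gr.isClosedEmbedding_proj : Topology.IsClosedEmbedding (Gr.proj : Gr K r → _) :=
  Gr.continuous_proj.isClosedEmbedding Gr.proj_injective

instance : SecondCountableTopology (Gr K r) :=
  Gr.isClosedEmbedding_proj.isEmbedding.secondCountableTopology

theorem Gr.continuous_act :
    Continuous fun x : U2r K r × Gr K r => Gr.act (Unitary.toUnits x.1) x.2 := by
  rw [Gr.isClosedEmbedding_proj.isEmbedding.continuous_iff]
  have : (Gr.proj ∘ fun x : U2r K r × Gr K r => Gr.act (Unitary.toUnits x.1) x.2) = fun x =>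
      (x.1 : Matrix (Fin r ⊕ Fin r) (Fin r ⊕ Fin r) K) * Gr.proj x.2 *
        star (x.1 : Matrix (Fin r ⊕ Fin r) (Fin r ⊕ Fin r) K) := by
    ext1 x
    exact Gr.proj_act_unitary _ _
  rw [this]
  have h : Continuous fun x : U2r K r × Gr K r =>
      (x.1 : Matrix (Fin r ⊕ Fin r) (Fin r ⊕ Fin r) K) := continuous_subtype_val.comp continuous_fst
  exact (h.matrix_mul (Gr.continuous_proj.comp continuous_snd)).matrix_mul h.star

/-- The chart of the big cell. -/
def Gr.chart (Y : Matrix (Fin r) (Fin r) K) : Gr K r := Gr.act (nbar Y) (Gr.base K r)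

theorem Gr.continuous_chart : Continuous (Gr.chart : Matrix (Fin r) (Fin r) K → Gr K r) := by
  rw [Gr.isClosedEmbedding_proj.isEmbedding.continuous_iff]
  have : (Gr.proj ∘ Gr.chart : Matrix (Fin r) (Fin r) K → _) = fun Y => projMat (nbar Y) := by
    ext1 Y
    exact Gr.proj_act_base _
  rw [this]
  have hf : Continuous fun Y : Matrix (Fin r) (Fin r) K => frame (nbar Y) := by
    have h : Continuous fun Y : Matrix (Fin r) (Fin r) K =>
        (Matrix.fromBlocks 1 0 Y 1 : Matrix (Fin r ⊕ Fin r) (Fin r ⊕ Fin r) K) :=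
      Continuous.matrix_fromBlocks continuous_const continuous_const continuous_id continuous_const
    exact h.matrix_submatrix _ _
  have hg : Continuous fun Y : Matrix (Fin r) (Fin r) K =>
      Ring.inverse ((frame (nbar Y))ᴴ * frame (nbar Y)) := by
    rw [continuous_iff_continuousAt]
    intro Y
    exact (continuousAt_matrix_inverse (isUnit_frame_gram _)).comp
      (f := fun Y => (frame (nbar Y))ᴴ * frame (nbar Y))
      (hf.matrix_conjTranspose.matrix_mul hf).continuousAt
  exact (hf.matrix_mul hg).matrix_mul hf.matrix_conjTranspose

theorem continuous_weight : Continuous (weight : Matrix (Fin r) (Fin r) K → ℝ) := by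
  have h : ∀ Y : Matrix (Fin r) (Fin r) K, cocycle (nbar Y) = |detR (1 + Yᴴ * Y)| := by
    intro Y
    have h1 : detR ((nbar Y : GL2r K r) : Matrix (Fin r ⊕ Fin r) (Fin r ⊕ Fin r) K) = 1 :=
      detR_fromBlocks_one_lower Y
    have h2 : (frame (nbar Y))ᴴ * frame (nbar Y) = 1 + Yᴴ * Y := by
      ext i j
      rcases eq_or_ne i j with rfl | hij
      · simp [Matrix.mul_apply, frame, nbar, Matrix.one_apply]
      · simp [Matrix.mul_apply, frame, nbar, Matrix.one_apply, hij, hij.symm]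
    rw [cocycle, h1, h2, abs_one, div_one]
  unfold weight
  simp only [h]
  exact (continuous_detR.comp (continuous_const.add
    (continuous_id.matrix_conjTranspose.matrix_mul continuous_id))).abs.sqrt

theorem continuous_sinAngle : Continuous fun x : Gr K r × Gr K r => sinAngle x.1.1 x.2.1 := by
  -- Products of quotient maps need not be quotient maps; here the product is a continuous
  -- surjection from a compact space to a Hausdorff one, hence closed.
  have hq : Topology.IsQuotientMap (Prod.map
      (fun k : U2r K r => Gr.act (Unitary.toUnits k) (Gr.base K r))
      (fun k : U2r K r => Gr.act (Unitary.toUnits k) (Gr.base K r))) := by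
    have hc := Gr.isQuotientMap_orbit (K := K) (r := r)
    have hc' := hc.continuous.prodMap hc.continuous
    exact hc'.isClosedMap.isQuotientMap hc' (hc.surjective.prodMap hc.surjective)
  rw [hq.continuous_iff]
  have : ((fun x : Gr K r × Gr K r => sinAngle x.1.1 x.2.1) ∘ Prod.map
      (fun k : U2r K r => Gr.act (Unitary.toUnits k) (Gr.base K r))
      (fun k : U2r K r => Gr.act (Unitary.toUnits k) (Gr.base K r))) = fun x =>
      |detR (star (x.2 : Matrix (Fin r ⊕ Fin r) (Fin r ⊕ Fin r) K) *
        (x.1 : Matrix (Fin r ⊕ Fin r) (Fin r ⊕ Fin r) K)).toBlocks₂₁| ^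
          ((1 : ℝ) / Module.finrank ℝ K) := by
    ext1 x
    exact sinAngle_unitary x.1 x.2
  rw [this]
  have h1 : Continuous fun x : U2r K r × U2r K r =>
      (x.1 : Matrix (Fin r ⊕ Fin r) (Fin r ⊕ Fin r) K) := continuous_subtype_val.comp continuous_fst
  have h2 : Continuous fun x : U2r K r × U2r K r =>
      (x.2 : Matrix (Fin r ⊕ Fin r) (Fin r ⊕ Fin r) K) := continuous_subtype_val.comp continuous_snd
  refine Continuous.rpow_const (continuous_detR.comp ?_).abs fun _ => Or.inr (by positivity)
  exact (h2.star.matrix_mul h1).matrix_submatrix _ _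

end GrTopology

/-! ### Uniqueness of the invariant measure -/

section Uniqueness

variable {K : Type*} [NormedDivisionRing K] [NormedAlgebra ℝ K] [StarRing K] [IsHurwitz K] {r : ℕ}

theorem Gr.continuous_act_unitary (k : U2r K r) :
    Continuous (Gr.act (K := K) (r := r) (Unitary.toUnits k)) :=
  Gr.continuous_act.comp (Continuous.prodMk_right k)

/-- Compute the measure of {(k, η) : k⁻¹η ∈ S} in two orders. For fixed k, invariance of `ν` gives ν
S; for fixed η = k'ξ₀, left invariance of `h` gives a value independent of k'. -/
theorem IsUInvariant.mul_measure_eq [MeasurableSpace (U2r K r)] [BorelSpace (U2r K r)]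
    (h : Measure (U2r K r)) [h.IsMulLeftInvariant] [IsFiniteMeasure h]
    {ν : Measure (Gr K r)} [IsFiniteMeasure ν] (hν : IsUInvariant ν) {S : Set (Gr K r)}
    (hS : MeasurableSet S) :
    h Set.univ * ν S =
      h {k | Gr.act (Unitary.toUnits k⁻¹) (Gr.base K r) ∈ S} * ν Set.univ := by
  have hcont : Continuous fun x : U2r K r × Gr K r => Gr.act (Unitary.toUnits x.1⁻¹) x.2 :=
    Gr.continuous_act.comp (continuous_inv.prodMap continuous_id)
  have hT : MeasurableSet {x : U2r K r × Gr K r | Gr.act (Unitary.toUnits x.1⁻¹) x.2 ∈ S} :=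
    hcont.measurable hS
  have h1 : (h.prod ν) {x : U2r K r × Gr K r | Gr.act (Unitary.toUnits x.1⁻¹) x.2 ∈ S} =
      h Set.univ * ν S := by
    rw [Measure.prod_apply hT]
    have : ∀ k : U2r K r, ν (Prod.mk k ⁻¹'
        {x : U2r K r × Gr K r | Gr.act (Unitary.toUnits x.1⁻¹) x.2 ∈ S}) = ν S := by
      intro k
      conv_rhs => rw [← hν k⁻¹, Measure.map_apply (Gr.continuous_act_unitary _).measurable hS]
      rfl
    simp only [this, lintegral_const, mul_comm]
  have h2 : (h.prod ν) {x : U2r K r × Gr K r | Gr.act (Unitary.toUnits x.1⁻¹) x.2 ∈ S} =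
      h {k | Gr.act (Unitary.toUnits k⁻¹) (Gr.base K r) ∈ S} * ν Set.univ := by
    rw [Measure.prod_apply_symm hT]
    have : ∀ η : Gr K r, h ((fun k => (k, η)) ⁻¹'
        {x : U2r K r × Gr K r | Gr.act (Unitary.toUnits x.1⁻¹) x.2 ∈ S}) =
        h {k | Gr.act (Unitary.toUnits k⁻¹) (Gr.base K r) ∈ S} := by
      intro η
      obtain ⟨k', rfl⟩ := Gr.exists_unitary η
      rw [← measure_preimage_mul h k'⁻¹ {k | Gr.act (Unitary.toUnits k⁻¹) (Gr.base K r) ∈ S}]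
      congr 1
      ext k
      simp only [Set.mem_preimage, Set.mem_ofPred_eq, mul_inv_rev, inv_inv, map_mul, Gr.act_mul]
    simp only [this, lintegral_const]
  rw [← h1, h2]

/-- The first factor on the right of `IsUInvariant.mul_measure_eq` does not involve the measure on
the Grassmannian, so it can be eliminated between `μ` and `ν`. -/
theorem IsUInvariant.eq_smul {μ ν : Measure (Gr K r)} [IsProbabilityMeasure μ] [IsFiniteMeasure ν]
    (hμ : IsUInvariant μ) (hν : IsUInvariant ν) : ν = ν Set.univ • μ := by
  let _ : MeasurableSpace (U2r K r) := borel _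
  have : BorelSpace (U2r K r) := ⟨rfl⟩
  let h : Measure (U2r K r) := Measure.haar
  have : IsFiniteMeasure h := ⟨isCompact_univ.measure_lt_top⟩
  have h0 : h Set.univ ≠ 0 := isOpen_univ.measure_ne_zero h Set.univ_nonempty
  ext S hS
  have h1 := hμ.mul_measure_eq h hS
  have h2 := hν.mul_measure_eq h hS
  rw [measure_univ (μ := μ), mul_one] at h1
  rw [← h1, mul_assoc] at h2
  rw [(ENNReal.mul_right_inj h0 (measure_ne_top h _)).1 h2, Measure.smul_apply, smul_eq_mul,
    mul_comm]

end Uniqueness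

/-! ### The invariant measure in the chart -/

section Lebesgue

variable {K : Type*} [NormedDivisionRing K] [NormedAlgebra ℝ K] [StarRing K] [IsHurwitz K] {r : ℕ}

section Linear

variable {E : Type*} [AddCommGroup E] [Module ℝ E] [TopologicalSpace E]
  [IsTopologicalAddGroup E] [ContinuousSMul ℝ E] [T2Space E] [FiniteDimensional ℝ E]
  [MeasurableSpace E] [BorelSpace E]

/-- `E` has a topology but no chosen norm, so the change of variables is transported from ℝ^d along
a linear isomorphism. -/
theorem map_linearMap_eq_smul (μ : Measure E) [μ.IsAddHaarMeasure] {L : E →ₗ[ℝ] E}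
    (hL : LinearMap.det L ≠ 0) :
    μ.map L = ENNReal.ofReal |(LinearMap.det L)⁻¹| • μ := by
  let e : E ≃L[ℝ] (Fin (Module.finrank ℝ E) → ℝ) := ContinuousLinearEquiv.ofFinrankEq (by simp)
  have hν : (μ.map e).IsAddHaarMeasure := e.isAddHaarMeasure_map μ
  have hme : Measurable e := e.continuous.measurable
  have hms : Measurable e.symm := e.symm.continuous.measurable
  have hmL : Measurable L := L.continuous_of_finiteDimensional.measurable
  let L' := e.toLinearEquiv.toLinearMap ∘ₗ L ∘ₗ e.toLinearEquiv.symm.toLinearMap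
  have hmL' : Measurable L' := L'.continuous_of_finiteDimensional.measurable
  have hdet : LinearMap.det L' = LinearMap.det L := LinearMap.det_conj L e.toLinearEquiv
  have h := Measure.map_linearMap_addHaar_eq_smul_addHaar (μ.map e) (hdet.symm ▸ hL)
  rw [hdet, Measure.map_map hmL' hme] at h
  have h1 := congrArg (Measure.map e.symm) h
  rw [Measure.map_map hms (hmL'.comp hme), Measure.map_smul, Measure.map_map hms hme] at h1
  have h2 : e.symm ∘ L' ∘ e = L := by
    ext x
    simp [L']
  have h3 : e.symm ∘ e = id := by
    ext x
    simp
  rwa [h2, h3, Measure.map_id] at h1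

theorem lintegral_comp_linearMap (μ : Measure E) [μ.IsAddHaarMeasure]
    {L : E →ₗ[ℝ] E} (hL : LinearMap.det L ≠ 0) {f : E → ENNReal} (hf : Measurable f) :
    ∫⁻ x, f x ∂μ = ENNReal.ofReal |LinearMap.det L| * ∫⁻ x, f (L x) ∂μ := by
  rw [← lintegral_map hf L.continuous_of_finiteDimensional.measurable,
    map_linearMap_eq_smul μ hL, lintegral_smul_measure, smul_eq_mul,
    ← mul_assoc, ← ENNReal.ofReal_mul (abs_nonneg _), ← abs_mul, mul_inv_cancel₀ hL]
  simp

end Linear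

instance {m n : Type*} [Finite m] [Finite n] : LocallyCompactSpace (Matrix m n K) :=
  inferInstanceAs (LocallyCompactSpace (m → n → K))

/-- If A + x·1 is singular, then -x is an eigenvalue of a real linear map in finite dimension. -/
theorem finite_not_isUnit_add_smul_one (A : Matrix (Fin r) (Fin r) K) :
    {x : ℝ | ¬ IsUnit (A + x • (1 : Matrix (Fin r) (Fin r) K))}.Finite := by
  have h := (Module.End.finite_hasEigenvalue (mulVecR A)).preimage
    (f := fun x : ℝ => -x) neg_injective.injOn
  refine h.subset fun x hx => ?_
  have h1 : ∃ v, (A + x • (1 : Matrix (Fin r) (Fin r) K)) *ᵥ v = 0 ∧ v ≠ 0 := by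
    by_contra hv
    push Not at hv
    exact hx (isUnit_of_mulVec_injective hv)
  obtain ⟨v, hv, hv0⟩ := h1
  refine Module.End.hasEigenvalue_of_hasEigenvector (x := v) ⟨?_, hv0⟩
  rw [Module.End.mem_eigenspace_iff, mulVecR_apply]
  rw [Matrix.add_mulVec, Matrix.smul_mulVec, Matrix.one_mulVec] at hv
  rw [neg_smul]
  exact eq_neg_of_add_eq_zero_left hv

variable [MeasurableSpace (Matrix (Fin r) (Fin r) K)] [BorelSpace (Matrix (Fin r) (Fin r) K)]

/-- Fubini along the lines A + x·1: each meets the singular set in finitely many points, and by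
translation invariance every slice in the other direction has the measure of the singular set
itself. -/
theorem ae_isUnit (dY : Measure (Matrix (Fin r) (Fin r) K)) [dY.IsAddHaarMeasure] :
    ∀ᵐ A ∂dY, IsUnit A := by
  have hs : MeasurableSet {A : Matrix (Fin r) (Fin r) K | ¬ IsUnit A} :=
    isOpen_setOf_isUnit.measurableSet.compl
  -- An atomless measure of total mass 1, so that the constant slice measure is recovered unchanged.
  let ρ : Measure ℝ := volume.restrict (Set.Icc 0 1)
  have hc : Continuous fun x : ℝ × Matrix (Fin r) (Fin r) K =>
      x.2 + x.1 • (1 : Matrix (Fin r) (Fin r) K) :=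
    continuous_snd.add (continuous_fst.smul continuous_const)
  have hT : MeasurableSet {x : ℝ × Matrix (Fin r) (Fin r) K |
      ¬ IsUnit (x.2 + x.1 • (1 : Matrix (Fin r) (Fin r) K))} := hc.measurable hs
  have h1 := Measure.prod_apply (μ := ρ) (ν := dY) hT
  have h2 : ∀ x : ℝ, dY (Prod.mk x ⁻¹' {x : ℝ × Matrix (Fin r) (Fin r) K |
      ¬ IsUnit (x.2 + x.1 • (1 : Matrix (Fin r) (Fin r) K))}) =
      dY {A : Matrix (Fin r) (Fin r) K | ¬ IsUnit A} := fun x =>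
    measure_preimage_add_right dY (x • (1 : Matrix (Fin r) (Fin r) K)) {A | ¬ IsUnit A}
  have h3 : ∀ A : Matrix (Fin r) (Fin r) K, ρ ((fun x => (x, A)) ⁻¹'
      {x : ℝ × Matrix (Fin r) (Fin r) K |
        ¬ IsUnit (x.2 + x.1 • (1 : Matrix (Fin r) (Fin r) K))}) = 0 := fun A =>
    (finite_not_isUnit_add_smul_one A).measure_zero ρ
  rw [Measure.prod_apply_symm hT] at h1
  simp only [h2, h3, lintegral_const] at h1
  simpa [ρ, ae_iff, eq_comm] using h1

/-- Left multiplication by a matrix in `r × r` blocks on pairs of blocks. -/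
def pairMul (g : Matrix (Fin r ⊕ Fin r) (Fin r ⊕ Fin r) K) :
    (Matrix (Fin r) (Fin r) K × Matrix (Fin r) (Fin r) K) →ₗ[ℝ]
      (Matrix (Fin r) (Fin r) K × Matrix (Fin r) (Fin r) K) where
  toFun z := (g.toBlocks₁₁ * z.1 + g.toBlocks₁₂ * z.2, g.toBlocks₂₁ * z.1 + g.toBlocks₂₂ * z.2)
  map_add' x y := by
    ext1 <;> simp only [Prod.fst_add, Prod.snd_add, Matrix.mul_add] <;> abel
  map_smul' c x := by
    ext1 <;> simp

/-- The matrix `[A; C]` of a pair of blocks. -/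
def stack (z : Matrix (Fin r) (Fin r) K × Matrix (Fin r) (Fin r) K) :
    Matrix (Fin r ⊕ Fin r) (Fin r) K := Matrix.fromRows z.1 z.2

theorem stack_pairMul (g : Matrix (Fin r ⊕ Fin r) (Fin r ⊕ Fin r) K)
    (z : Matrix (Fin r) (Fin r) K × Matrix (Fin r) (Fin r) K) :
    stack (pairMul g z) = g * stack z := by
  conv_rhs => rw [← Matrix.fromBlocks_toBlocks g]
  rw [stack, stack, Matrix.fromBlocks_mul_fromRows]
  rfl

theorem stack_injective : Function.Injective
    (stack : Matrix (Fin r) (Fin r) K × Matrix (Fin r) (Fin r) K → _) := by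
  rintro ⟨A, C⟩ ⟨A', C'⟩ h
  obtain ⟨h1, h2⟩ := Matrix.fromRows_inj h
  exact Prod.ext h1 h2

theorem pairMul_mul (g h : Matrix (Fin r ⊕ Fin r) (Fin r ⊕ Fin r) K)
    (z : Matrix (Fin r) (Fin r) K × Matrix (Fin r) (Fin r) K) :
    pairMul (g * h) z = pairMul g (pairMul h z) := by
  apply stack_injective
  simp only [stack_pairMul, Matrix.mul_assoc]

theorem pairMul_one (z : Matrix (Fin r) (Fin r) K × Matrix (Fin r) (Fin r) K) :
    pairMul 1 z = z := by
  apply stack_injective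
  rw [stack_pairMul, Matrix.one_mul]

/-- The pairs of blocks all of whose columns have length less than one. -/
def tube (K : Type*) [NormedDivisionRing K] [StarRing K] (r : ℕ) :
    Set (Matrix (Fin r) (Fin r) K × Matrix (Fin r) (Fin r) K) :=
  {z | ∀ j, ‖((stack z)ᴴ * stack z) j j‖ < 1}

theorem gram_pairMul_unitary (k : U2r K r)
    (z : Matrix (Fin r) (Fin r) K × Matrix (Fin r) (Fin r) K) :
    (stack (pairMul (k : Matrix (Fin r ⊕ Fin r) (Fin r ⊕ Fin r) K) z))ᴴ *
      stack (pairMul (k : Matrix (Fin r ⊕ Fin r) (Fin r ⊕ Fin r) K) z) =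
      (stack z)ᴴ * stack z := by
  rw [stack_pairMul, Matrix.conjTranspose_mul, Matrix.mul_assoc,
    ← Matrix.mul_assoc _ _ (stack z), unitary_conjTranspose_mul k.2, Matrix.one_mul]

theorem pairMul_unitary_mem_tube (k : U2r K r)
    (z : Matrix (Fin r) (Fin r) K × Matrix (Fin r) (Fin r) K) :
    pairMul (k : Matrix (Fin r ⊕ Fin r) (Fin r ⊕ Fin r) K) z ∈ tube K r ↔ z ∈ tube K r := by
  rw [tube, Set.mem_ofPred_eq, gram_pairMul_unitary]
  rfl

theorem continuous_stack : Continuous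
    (stack : Matrix (Fin r) (Fin r) K × Matrix (Fin r) (Fin r) K → _) := by
  refine continuous_matrix fun i j => ?_
  rcases i with i | i
  · exact (continuous_apply_apply (ρ := fun _ _ => K) i j).comp continuous_fst
  · exact (continuous_apply_apply (ρ := fun _ _ => K) i j).comp continuous_snd

theorem isOpen_tube : IsOpen (tube K r) := by
  have h : tube K r = ⋂ j, {z | ‖((stack z)ᴴ * stack z) j j‖ < 1} := by
    ext z
    simp [tube]
  rw [h]
  refine isOpen_iInter_of_finite fun j => isOpen_lt ?_ continuous_const
  exact ((continuous_stack.matrix_conjTranspose.matrix_mul continuous_stack).matrix_elem j j).norm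

theorem zero_mem_tube : (0 : Matrix (Fin r) (Fin r) K × Matrix (Fin r) (Fin r) K) ∈ tube K r := by
  intro j
  have : stack (0 : Matrix (Fin r) (Fin r) K × Matrix (Fin r) (Fin r) K) = 0 :=
    Matrix.fromRows_zero
  simp [this]

theorem norm_stack_le_of_mem_tube {z : Matrix (Fin r) (Fin r) K × Matrix (Fin r) (Fin r) K}
    (hz : z ∈ tube K r) (i : Fin r ⊕ Fin r) (j : Fin r) : ‖stack z i j‖ ≤ 1 := by
  have h := hz j
  have h1 : ((stack z)ᴴ * stack z) j j =
      algebraMap ℝ K (∑ i, ‖stack z i j‖ ^ 2) := by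
    rw [← star_dotProduct_self (fun i => stack z i j), Matrix.mul_apply]
    rfl
  rw [h1, norm_algebraMap', Real.norm_of_nonneg (Finset.sum_nonneg fun i _ => by positivity)] at h
  have h2 := Finset.single_le_sum (f := fun i => ‖stack z i j‖ ^ 2)
    (fun i _ => by positivity) (Finset.mem_univ i)
  have h3 := h2.trans h.le
  simpa using h3

theorem exists_isCompact_tube_subset : ∃ T, IsCompact T ∧ tube K r ⊆ T := by
  have hc : IsCompact (Set.univ.pi fun _ : Fin r => Set.univ.pi fun _ : Fin r =>
      Metric.closedBall (0 : K) 1) :=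
    isCompact_univ_pi fun _ => isCompact_univ_pi fun _ => isCompact_closedBall _ _
  have hc' := IsCompact.prod (X := Matrix (Fin r) (Fin r) K) (Y := Matrix (Fin r) (Fin r) K) hc hc
  refine ⟨_, hc', fun z hz => ⟨fun i _ j _ => ?_, fun i _ j _ => ?_⟩⟩
  · exact mem_closedBall_zero_iff.2 (norm_stack_le_of_mem_tube hz (Sum.inl i) j)
  · exact mem_closedBall_zero_iff.2 (norm_stack_le_of_mem_tube hz (Sum.inr i) j)

variable (dY : Measure (Matrix (Fin r) (Fin r) K)) [dY.IsAddHaarMeasure]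

theorem measure_tube_ne_zero : (dY.prod dY) (tube K r) ≠ 0 :=
  isOpen_tube.measure_ne_zero _ ⟨0, zero_mem_tube⟩

theorem measure_tube_ne_top : (dY.prod dY) (tube K r) ≠ ⊤ := by
  obtain ⟨T, hT, h⟩ := exists_isCompact_tube_subset (K := K) (r := r)
  exact ((measure_mono h).trans_lt hT.measure_lt_top).ne

theorem det_pairMul_unitary_ne_zero (k : U2r K r) :
    LinearMap.det (pairMul (k : Matrix (Fin r ⊕ Fin r) (Fin r ⊕ Fin r) K)) ≠ 0 := by
  have h : pairMul (k : Matrix (Fin r ⊕ Fin r) (Fin r ⊕ Fin r) K) *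
      pairMul (star (k : Matrix (Fin r ⊕ Fin r) (Fin r ⊕ Fin r) K)) = 1 := by
    apply LinearMap.ext
    intro z
    rw [Module.End.mul_apply, ← pairMul_mul, Unitary.mul_star_self_of_mem k.2, pairMul_one]
    rfl
  intro h0
  have h1 := congrArg LinearMap.det h
  rw [map_mul, h0, zero_mul, map_one] at h1
  exact zero_ne_one h1

theorem preimage_pairMul_tube (k : U2r K r) :
    pairMul (k : Matrix (Fin r ⊕ Fin r) (Fin r ⊕ Fin r) K) ⁻¹' tube K r = tube K r :=
  Set.ext (pairMul_unitary_mem_tube k)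

/-- The Jacobian need not be computed: a linear bijection preserving a set of finite positive
measure has Jacobian of absolute value 1. -/
theorem map_pairMul_unitary (k : U2r K r) :
    ((dY.prod dY).restrict (tube K r)).map
      (pairMul (k : Matrix (Fin r ⊕ Fin r) (Fin r ⊕ Fin r) K)) =
      (dY.prod dY).restrict (tube K r) := by
  have hm : Measurable (pairMul (k : Matrix (Fin r ⊕ Fin r) (Fin r ⊕ Fin r) K)) :=
    (LinearMap.continuous_of_finiteDimensional _).measurable
  have h1 := map_linearMap_eq_smul (dY.prod dY) (det_pairMul_unitary_ne_zero k)
  have h2 := congrArg (fun ν => ν (tube K r)) h1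
  simp only [Measure.map_apply hm isOpen_tube.measurableSet, preimage_pairMul_tube,
    Measure.smul_apply, smul_eq_mul] at h2
  have h3 : ENNReal.ofReal
      |(LinearMap.det (pairMul (k : Matrix (Fin r ⊕ Fin r) (Fin r ⊕ Fin r) K)))⁻¹| = 1 :=
    (ENNReal.mul_left_inj (measure_tube_ne_zero dY) (measure_tube_ne_top dY)).1
      (by rw [one_mul]; exact h2.symm)
  rw [h3, one_smul] at h1
  conv_rhs => rw [← h1, Measure.restrict_map hm isOpen_tube.measurableSet, preimage_pairMul_tube]

/-- The point of the Grassmannian spanned by the columns of `[A; C]`, for invertible `A`. -/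
def spanPair (z : Matrix (Fin r) (Fin r) K × Matrix (Fin r) (Fin r) K) : Gr K r :=
  Gr.chart (z.2 * Ring.inverse z.1)

theorem mem_spanPair {z : Matrix (Fin r) (Fin r) K × Matrix (Fin r) (Fin r) K} (hz : IsUnit z.1)
    {w : Fin r ⊕ Fin r → K} : w ∈ (spanPair z).1 ↔ ∃ a, stack z *ᵥ a = w := by
  have h : ∀ b, frame (nbar (z.2 * Ring.inverse z.1)) *ᵥ b =
      stack z *ᵥ (Ring.inverse z.1 *ᵥ b) := by
    intro b
    have h1 : frame (nbar (z.2 * Ring.inverse z.1)) = stack z * Ring.inverse z.1 := by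
      rw [stack, Matrix.fromRows_mul, Ring.mul_inverse_cancel _ hz]
      ext (i | i) j <;> simp [frame, nbar, Matrix.one_apply]
    rw [h1, Matrix.mulVec_mulVec]
  rw [spanPair, Gr.chart, Gr.mem_act_base]
  constructor
  · rintro ⟨b, rfl⟩
    exact ⟨_, (h b).symm⟩
  · rintro ⟨a, rfl⟩
    refine ⟨z.1 *ᵥ a, ?_⟩
    rw [h, Matrix.mulVec_mulVec _ _ z.1, Ring.inverse_mul_cancel _ hz, Matrix.one_mulVec]

theorem act_spanPair (k : U2r K r) {z : Matrix (Fin r) (Fin r) K × Matrix (Fin r) (Fin r) K}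
    (hz : IsUnit z.1)
    (hkz : IsUnit (pairMul (k : Matrix (Fin r ⊕ Fin r) (Fin r ⊕ Fin r) K) z).1) :
    Gr.act (Unitary.toUnits k) (spanPair z) =
      spanPair (pairMul (k : Matrix (Fin r ⊕ Fin r) (Fin r ⊕ Fin r) K) z) := by
  apply Gr.eq_of_le
  rintro _ ⟨v, hv, rfl⟩
  obtain ⟨a, rfl⟩ := (mem_spanPair hz).1 hv
  refine (mem_spanPair hkz).2 ⟨a, ?_⟩
  rw [stack_pairMul, ← Matrix.mulVec_mulVec]
  rfl

theorem measurable_spanPair : Measurable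
    (spanPair : Matrix (Fin r) (Fin r) K × Matrix (Fin r) (Fin r) K → Gr K r) := by
  have h : Continuous fun z : Matrix (Fin r) (Fin r) K × Matrix (Fin r) (Fin r) K => z.1 * z.2 :=
    continuous_fst.matrix_mul continuous_snd
  exact Gr.continuous_chart.measurable.comp (h.measurable.comp
    (measurable_snd.prodMk (measurable_matrix_inverse.comp measurable_fst)))

theorem ae_isUnit_fst : ∀ᵐ z ∂(dY.prod dY), IsUnit z.1 :=
  Measure.quasiMeasurePreserving_fst.ae (ae_isUnit dY)

/-- The column span is equivariant where the upper blocks before and after acting are both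
invertible, which is almost everywhere because the action preserves the measure. -/
theorem isUInvariant_map_spanPair :
    IsUInvariant (((dY.prod dY).restrict (tube K r)).map spanPair) := by
  intro k
  have hm : Measurable (pairMul (k : Matrix (Fin r ⊕ Fin r) (Fin r ⊕ Fin r) K)) :=
    (LinearMap.continuous_of_finiteDimensional _).measurable
  have h1 : ∀ᵐ z ∂((dY.prod dY).restrict (tube K r)), IsUnit z.1 :=
    ae_restrict_of_ae (ae_isUnit_fst dY)
  have h2 : ∀ᵐ z ∂((dY.prod dY).restrict (tube K r)),
      IsUnit (pairMul (k : Matrix (Fin r ⊕ Fin r) (Fin r ⊕ Fin r) K) z).1 := by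
    have h3 := h1
    rw [← map_pairMul_unitary dY k] at h3
    exact ae_of_ae_map hm.aemeasurable h3
  rw [Measure.map_map (Gr.continuous_act_unitary k).measurable measurable_spanPair]
  conv_rhs => rw [← map_pairMul_unitary dY k, Measure.map_map measurable_spanPair hm]
  apply Measure.map_congr
  filter_upwards [h1, h2] with z hz1 hz2
  exact act_spanPair k hz1 hz2

/-- The density of the invariant measure in the chart of the big cell. -/
def density (Y : Matrix (Fin r) (Fin r) K) : ENNReal := ENNReal.ofReal ((weight Y)⁻¹ ^ (2 * r))

theorem measurable_density : Measurable (density : Matrix (Fin r) (Fin r) K → ENNReal) :=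
  ((continuous_weight.inv₀ fun Y => (weight_pos Y).ne').pow _).measurable.ennreal_ofReal

/-- The normalizing constant comparing the invariant measure with `density`. -/
def tubeConst : ENNReal :=
  ∫⁻ A, (tube K r).indicator (fun z => ENNReal.ofReal (|detR z.1| ^ r)) (A, 0) ∂dY

/-- With n̄_Y = k p, [A; Y A] = n̄_Y [A; 0] = k [B A; 0], and the tube is unitarily invariant. -/
theorem mem_tube_mul (Y : Matrix (Fin r) (Fin r) K) :
    ∃ B : Matrix (Fin r) (Fin r) K, |detR B| = weight Y ∧
      ∀ A, (A, Y * A) ∈ tube K r ↔ (B * A, 0) ∈ tube K r := by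
  obtain ⟨k, p, hp, h, hB, -⟩ := exists_nbar_eq Y
  refine ⟨_, hB, fun A => ?_⟩
  have h1 : (A, Y * A) = pairMul (k : Matrix (Fin r ⊕ Fin r) (Fin r ⊕ Fin r) K)
      ((p : Matrix (Fin r ⊕ Fin r) (Fin r ⊕ Fin r) K).toBlocks₁₁ * A, 0) := by
    have h2 : ((p : Matrix (Fin r ⊕ Fin r) (Fin r ⊕ Fin r) K).toBlocks₁₁ * A, 0) =
        pairMul (p : Matrix (Fin r ⊕ Fin r) (Fin r ⊕ Fin r) K) (A, 0) := by
      have : (p : Matrix (Fin r ⊕ Fin r) (Fin r ⊕ Fin r) K).toBlocks₂₁ = 0 := hp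
      simp [pairMul, this]
    have h3 : (A, Y * A) = pairMul ((nbar Y : GL2r K r) :
        Matrix (Fin r ⊕ Fin r) (Fin r ⊕ Fin r) K) (A, 0) := by
      simp [pairMul, nbar]
    rw [h2, ← pairMul_mul, h3, h, Units.val_mul, Unitary.val_toUnits_apply]
  rw [h1, pairMul_unitary_mem_tube]

/-- Substituting B A for A yields w^(-r) from the integrand |det A|^r and another w^(-r) as Jacobian
on r × r matrices; hence the exponent 2r in `density`. -/
theorem lintegral_tube_mul (Y : Matrix (Fin r) (Fin r) K) :
    ∫⁻ A, (tube K r).indicator (fun z => ENNReal.ofReal (|detR z.1| ^ r)) (A, Y * A) ∂dY =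
      density Y * tubeConst dY := by
  obtain ⟨B, hB, h⟩ := mem_tube_mul Y
  have hw := weight_pos Y
  have hdet : LinearMap.det (leftMul (Fin r) B) ≠ 0 := by
    rw [det_leftMul]
    exact pow_ne_zero _ (abs_pos.1 (hB ▸ hw))
  have hmeas : Measurable fun A : Matrix (Fin r) (Fin r) K =>
      (tube K r).indicator (fun z => ENNReal.ofReal (|detR z.1| ^ r)) (A, 0) := by
    refine Measurable.comp (g := (tube K r).indicator fun z => ENNReal.ofReal (|detR z.1| ^ r))
      (Measurable.indicator ?_ isOpen_tube.measurableSet) measurable_prodMk_right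
    exact (((continuous_detR.comp continuous_fst).abs).pow r).measurable.ennreal_ofReal
  have h1 : ∀ A, (tube K r).indicator (fun z => ENNReal.ofReal (|detR z.1| ^ r)) (A, Y * A) =
      ENNReal.ofReal ((weight Y)⁻¹ ^ r) *
        (tube K r).indicator (fun z => ENNReal.ofReal (|detR z.1| ^ r)) (leftMul (Fin r) B A, 0) := by
    intro A
    by_cases hA : (A, Y * A) ∈ tube K r
    · have hA' : (leftMul (Fin r) B A, (0 : Matrix (Fin r) (Fin r) K)) ∈ tube K r := (h A).1 hA
      rw [Set.indicator_of_mem hA, Set.indicator_of_mem hA',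
        ← ENNReal.ofReal_mul (by positivity)]
      congr 1
      change _ = _ * |detR (B * A)| ^ r
      rw [detR_mul, abs_mul, hB, mul_pow, ← mul_assoc, ← mul_pow, inv_mul_cancel₀ hw.ne', one_pow,
        one_mul]
    · have hA' : (leftMul (Fin r) B A, (0 : Matrix (Fin r) (Fin r) K)) ∉ tube K r :=
        fun h' => hA ((h A).2 h')
      rw [Set.indicator_of_notMem hA, Set.indicator_of_notMem hA', mul_zero]
  have h2 := lintegral_comp_linearMap dY hdet hmeas
  rw [det_leftMul, Fintype.card_fin, abs_pow, hB] at h2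
  simp only [h1]
  rw [lintegral_const_mul' _ _ ENNReal.ofReal_ne_top, tubeConst, h2, density, ← mul_assoc,
    ← ENNReal.ofReal_mul (by positivity)]
  congr 2
  rw [two_mul, pow_add, mul_assoc, ← mul_pow, inv_mul_cancel₀ hw.ne', one_pow, mul_one]

/-- For invertible A, substitute C = Y A, with Jacobian |det_ℝ A|^r. The span of [A; Y A] is the
chart point of Y, so after exchanging the integrals the A-integral is the one in
`lintegral_tube_mul`. -/
theorem map_spanPair_eq :
    ((dY.prod dY).restrict (tube K r)).map spanPair =
      tubeConst dY • (dY.withDensity density).map Gr.chart := by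
  ext S hS
  have hmul : Measurable fun z : Matrix (Fin r) (Fin r) K × Matrix (Fin r) (Fin r) K =>
      (z.1, z.2 * z.1) :=
    (continuous_fst.prodMk (continuous_snd.matrix_mul continuous_fst)).measurable
  have hS' : MeasurableSet (Gr.chart ⁻¹' S : Set (Matrix (Fin r) (Fin r) K)) :=
    Gr.continuous_chart.measurable hS
  have hdet : Measurable fun z : Matrix (Fin r) (Fin r) K × Matrix (Fin r) (Fin r) K =>
      ENNReal.ofReal (|detR z.1| ^ r) :=
    (((continuous_detR.comp continuous_fst).abs).pow r).measurable.ennreal_ofReal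
  rw [Measure.map_apply measurable_spanPair hS, Measure.restrict_apply (measurable_spanPair hS),
    ← lintegral_indicator_one ((measurable_spanPair hS).inter isOpen_tube.measurableSet),
    lintegral_prod _ (measurable_one.indicator
      ((measurable_spanPair hS).inter isOpen_tube.measurableSet)).aemeasurable,
    Measure.smul_apply, Measure.map_apply Gr.continuous_chart.measurable hS,
    withDensity_apply _ hS', smul_eq_mul]
  have h1 : ∀ᵐ A ∂dY, (∫⁻ C, (spanPair ⁻¹' S ∩ tube K r).indicator
      (1 : Matrix (Fin r) (Fin r) K × Matrix (Fin r) (Fin r) K → ENNReal) (A, C) ∂dY) =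
      ∫⁻ Y, (Gr.chart ⁻¹' S).indicator 1 Y *
        (tube K r).indicator (fun z => ENNReal.ofReal (|detR z.1| ^ r)) (A, Y * A) ∂dY := by
    filter_upwards [ae_isUnit dY] with A hA
    have hA0 : LinearMap.det (rightMul (Fin r) A) ≠ 0 := by
      rw [det_rightMul]
      exact pow_ne_zero _ (detR_ne_zero_of_isUnit hA)
    rw [lintegral_comp_linearMap dY hA0 (f := fun C => (spanPair ⁻¹' S ∩ tube K r).indicator
      (1 : Matrix (Fin r) (Fin r) K × Matrix (Fin r) (Fin r) K → ENNReal) (A, C))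
      ((measurable_one.indicator ((measurable_spanPair hS).inter
        isOpen_tube.measurableSet)).comp measurable_prodMk_left),
      ← lintegral_const_mul' _ _ ENNReal.ofReal_ne_top]
    apply lintegral_congr
    intro Y
    have hY : spanPair (A, Y * A) = Gr.chart Y := by
      simp only [spanPair, Matrix.mul_assoc, Ring.mul_inverse_cancel _ hA, Matrix.mul_one]
    change _ * (spanPair ⁻¹' S ∩ tube K r).indicator 1 (A, Y * A) = _
    rw [det_rightMul, Fintype.card_fin, abs_pow]
    by_cases hYS : Gr.chart Y ∈ S <;> by_cases hYt : (A, Y * A) ∈ tube K r <;>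
      simp [Set.indicator, hY, hYS, hYt]
  rw [lintegral_congr_ae h1, lintegral_lintegral_swap]
  · have h2 : ∀ Y, (∫⁻ A, (Gr.chart ⁻¹' S).indicator 1 Y *
        (tube K r).indicator (fun z => ENNReal.ofReal (|detR z.1| ^ r)) (A, Y * A) ∂dY) =
        tubeConst dY * (Gr.chart ⁻¹' S).indicator density Y := by
      intro Y
      rw [lintegral_const_mul', lintegral_tube_mul]
      · by_cases hYS : Gr.chart Y ∈ S <;> simp [Set.indicator, hYS, mul_comm]
      · by_cases hYS : Gr.chart Y ∈ S <;> simp [Set.indicator, hYS]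
    simp only [h2]
    rw [lintegral_const_mul _ (measurable_density.indicator hS'), lintegral_indicator hS']
  · refine Measurable.aemeasurable ?_
    exact ((measurable_one.indicator hS').comp measurable_snd).mul
      ((hdet.indicator isOpen_tube.measurableSet).comp hmul)

theorem exists_map_chart_eq {μ : Measure (Gr K r)} [IsProbabilityMeasure μ]
    (hμ : IsUInvariant μ) :
    ∃ c : ℝ, 0 < c ∧ (dY.withDensity density).map Gr.chart = ENNReal.ofReal c • μ := by
  have : IsFiniteMeasure ((dY.prod dY).restrict (tube K r)) :=
    ⟨by rw [Measure.restrict_apply_univ]; exact (measure_tube_ne_top dY).lt_top⟩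
  have h1 := hμ.eq_smul (isUInvariant_map_spanPair dY)
  rw [Measure.map_apply measurable_spanPair MeasurableSet.univ, Set.preimage_univ,
    Measure.restrict_apply_univ, map_spanPair_eq] at h1
  have h0 := measure_tube_ne_zero dY
  have ht := measure_tube_ne_top dY
  have h2 := congrArg (fun ν => ν Set.univ) h1
  simp only [Measure.smul_apply, measure_univ, smul_eq_mul, mul_one] at h2
  -- Comparing total masses: the tube has finite positive measure, which rules out both degenerate
  -- values of the constant.
  have hc0 : tubeConst dY ≠ 0 := by
    intro h
    rw [h, zero_mul] at h2
    exact h0 h2.symm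
  have hct : tubeConst dY ≠ ⊤ := by
    intro h
    rw [h, ENNReal.top_mul] at h2
    · exact ht h2.symm
    · intro h'
      rw [h', mul_zero] at h2
      exact h0 h2.symm
  refine ⟨((tubeConst dY)⁻¹ * (dY.prod dY) (tube K r)).toReal, ENNReal.toReal_pos ?_ ?_, ?_⟩
  · exact mul_ne_zero (ENNReal.inv_ne_zero.2 hct) h0
  · exact ENNReal.mul_ne_top (ENNReal.inv_ne_top.2 hc0) ht
  · rw [ENNReal.ofReal_toReal (ENNReal.mul_ne_top (ENNReal.inv_ne_top.2 hc0) ht), mul_smul, ← h1,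
      smul_smul, ENNReal.inv_mul_cancel hc0 hct, one_smul]

end Lebesgue

/-! ### Complex powers of nonnegative reals -/

theorem ofReal_rpow_cpow {x a : ℝ} (hx : 0 ≤ x) (ha : a ≠ 0) (s : ℂ) :
    ((x ^ (1 / a) : ℝ) : ℂ) ^ ((a : ℂ) * s) = (x : ℂ) ^ s := by
  rcases hx.eq_or_lt with rfl | hx
  · rw [Real.zero_rpow (one_div_ne_zero ha), Complex.ofReal_zero]
    -- At x = 0 both sides follow the same convention: 0^0 = 1, and 0^s = 0 for every other s. The
    -- two kernels therefore agree on the singular set as well.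
    by_cases hs : s = 0
    · simp [hs]
    · rw [Complex.zero_cpow hs, Complex.zero_cpow (mul_ne_zero (Complex.ofReal_ne_zero.2 ha) hs)]
  · have ha' : (a : ℂ) ≠ 0 := Complex.ofReal_ne_zero.2 ha
    have h1 : ((x ^ (1 / a) : ℝ) : ℂ) ≠ 0 :=
      Complex.ofReal_ne_zero.2 (Real.rpow_pos_of_pos hx _).ne'
    rw [Complex.cpow_def_of_ne_zero h1, Complex.cpow_def_of_ne_zero (Complex.ofReal_ne_zero.2 hx.ne'),
      ← Complex.ofReal_log (Real.rpow_pos_of_pos hx _).le, Real.log_rpow hx,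
      ← Complex.ofReal_log hx.le]
    congr 1
    push_cast
    field_simp

theorem ofReal_cpow_eq_exp {w : ℝ} (hw : 0 < w) (s : ℂ) :
    (w : ℂ) ^ s = Complex.exp ((Real.log w : ℂ) * s) := by
  rw [Complex.cpow_def_of_ne_zero (Complex.ofReal_ne_zero.2 hw.ne'), Complex.ofReal_log hw.le]

theorem norm_ofReal_cpow_le_one {x : ℝ} (hx : 0 ≤ x) (hx1 : x ≤ 1) {s : ℂ} (hs : 0 ≤ s.re) :
    ‖(x : ℂ) ^ s‖ ≤ 1 := by
  rcases hx.eq_or_lt with rfl | hx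
  · by_cases h : s = 0
    · simp [h]
    · simp [Complex.zero_cpow h]
  · rw [Complex.norm_cpow_eq_rpow_re_of_pos hx]
    exact Real.rpow_le_one hx.le hx1 hs

/-! ### Comparison of the two operators, and the bound on L² -/

section Transform

variable {K : Type*} [NormedDivisionRing K] [NormedAlgebra ℝ K] [StarRing K] [IsHurwitz K] {r : ℕ}

theorem measurable_sinAngle_cpow (s : ℂ) :
    Measurable fun x : Gr K r × Gr K r => ((sinAngle x.1.1 x.2.1 : ℝ) : ℂ) ^ s :=
  (Complex.measurable_ofReal.comp continuous_sinAngle.measurable).pow_const s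

theorem aestronglyMeasurable_sineIntegrand {μ : Measure (Gr K r)} (ν : ℂ) {f : Gr K r → ℂ}
    (hf : AEStronglyMeasurable f μ) (ξ : Gr K r) :
    AEStronglyMeasurable (sineIntegrand ν f ξ) μ :=
  ((measurable_sinAngle_cpow (2 * ν)).comp
    measurable_prodMk_left).aestronglyMeasurable.mul hf

section Chart

variable [MeasurableSpace (Matrix (Fin r) (Fin r) K)] [BorelSpace (Matrix (Fin r) (Fin r) K)]
  (dY : Measure (Matrix (Fin r) (Fin r) K)) [dY.IsAddHaarMeasure]

/-- The big cell is a countable union of compact sets. -/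
theorem measurableSet_range_chart :
    MeasurableSet (Set.range (Gr.chart : Matrix (Fin r) (Fin r) K → Gr K r)) := by
  rw [← Set.image_univ, ← iUnion_compactCovering, Set.image_iUnion]
  exact MeasurableSet.iUnion fun n =>
    ((isCompact_compactCovering _ n).image Gr.continuous_chart).isClosed.measurableSet

theorem ae_mem_range_chart (dY : Measure (Matrix (Fin r) (Fin r) K)) [dY.IsAddHaarMeasure]
    {μ : Measure (Gr K r)} [IsProbabilityMeasure μ]
    (hμ : IsUInvariant μ) : ∀ᵐ ξ ∂μ, ξ ∈ Set.range (Gr.chart : Matrix (Fin r) (Fin r) K → _) := by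
  obtain ⟨c, hc, h⟩ := exists_map_chart_eq dY hμ
  have h1 := ae_map_mem_range Gr.chart measurableSet_range_chart (dY.withDensity density)
  rw [h] at h1
  exact (Measure.ae_ennreal_smul_measure_iff (by simpa using hc)).1 h1

theorem inducedOf_nbar (s : ℂ) (f : Gr K r → ℂ) (Y : Matrix (Fin r) (Fin r) K) :
    inducedOf s f (nbar Y) =
      Complex.exp (-(Real.log (weight Y) : ℂ) * (2 * s + r)) * f (Gr.chart Y) := by
  have hw := weight_pos Y
  rw [inducedOf, cocycle_nbar, ofReal_cpow_eq_exp (by positivity), ← Complex.exp_neg, Real.log_pow,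
    Gr.chart]
  congr 2
  push_cast
  ring

theorem knappSteinIntegrand_eq (t : ℂ) (f : Gr K r → ℂ) (X Y : Matrix (Fin r) (Fin r) K) :
    knappSteinIntegrand t (noncompactPicture (inducedOf t f)) X Y =
      Complex.exp ((Real.log (weight X) : ℂ) * (-r + 2 * t)) *
        ((density Y).toReal • sineIntegrand (nuOf K r t) f (Gr.chart X) (Gr.chart Y)) := by
  have hX := weight_pos X
  have hY := weight_pos Y
  have hd : (((density Y).toReal : ℝ) : ℂ) =
      Complex.exp (-(Real.log (weight Y) : ℂ) * (2 * r)) := by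
    rw [density, ENNReal.toReal_ofReal (by positivity), Complex.ofReal_pow, ← Complex.cpow_natCast,
      ofReal_cpow_eq_exp (by positivity), Real.log_inv]
    push_cast
    rfl
  have ha : ((Module.finrank ℝ K : ℕ) : ℝ) ≠ 0 :=
    Nat.cast_ne_zero.2 (Module.finrank_pos (R := ℝ) (M := K)).ne'
  have hν : 2 * nuOf K r t = ((Module.finrank ℝ K : ℝ) : ℂ) * (-r + 2 * t) := by
    rw [nuOf]
    push_cast
    ring
  rw [knappSteinIntegrand, noncompactPicture, inducedOf_nbar, sineIntegrand, Gr.chart, Gr.chart,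
    sinAngle_nbar, hν, ofReal_rpow_cpow (by positivity) ha, Complex.real_smul, hd,
    Complex.ofReal_mul, Complex.mul_cpow_ofReal_nonneg (by positivity) (by positivity),
    Complex.ofReal_mul, Complex.mul_cpow_ofReal_nonneg (by positivity) (by positivity),
    ofReal_cpow_eq_exp (inv_pos.2 hX), ofReal_cpow_eq_exp (inv_pos.2 hY), Real.log_inv,
    Real.log_inv]
  -- The exponent identities: for w(Y), -2t - r = -2r - (-r + 2t); for w(X), the two exponents
  -- cancel.
  have he : Complex.exp (-(Real.log (weight Y) : ℂ) * (2 * t + r)) =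
      Complex.exp ((Real.log (weight X) : ℂ) * (-r + 2 * t)) *
        (Complex.exp (-(Real.log (weight Y) : ℂ) * (2 * r)) *
          (Complex.exp (((-Real.log (weight X) : ℝ) : ℂ) * (-r + 2 * t)) *
            Complex.exp (((-Real.log (weight Y) : ℝ) : ℂ) * (-r + 2 * t)))) := by
    simp only [← Complex.exp_add]
    congr 1
    push_cast
    ring
  rw [he]
  ring

/-- The pointwise identity of integrands is integrated against the density. Each step holds for the
Bochner integral without integrability, so the formula persists when both integrals are 0 by
convention. -/
theorem knappStein_eq_sineTransform {μ : Measure (Gr K r)} [IsProbabilityMeasure μ] {c : ℝ}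
    (hc : 0 < c) (h : (dY.withDensity density).map Gr.chart = ENNReal.ofReal c • μ) (t : ℂ)
    {f : Gr K r → ℂ} (hf : AEStronglyMeasurable f μ) (X : Matrix (Fin r) (Fin r) K) :
    (Integrable (knappSteinIntegrand t (noncompactPicture (inducedOf t f)) X) dY ↔
      Integrable (sineIntegrand (nuOf K r t) f (Gr.chart X)) μ) ∧
    knappStein dY t (noncompactPicture (inducedOf t f)) X =
      (c : ℂ) * noncompactPicture (inducedOf (-t) (sineTransform μ (nuOf K r t) f)) X := by
  have hd : ∀ᵐ Y ∂dY, density Y < ⊤ :=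
    Filter.Eventually.of_forall fun Y => ENNReal.ofReal_lt_top
  have hg : AEStronglyMeasurable (sineIntegrand (nuOf K r t) f (Gr.chart X))
      ((dY.withDensity density).map Gr.chart) := by
    rw [h]
    exact (aestronglyMeasurable_sineIntegrand _ hf _).smul_measure _
  have hm : AEMeasurable Gr.chart (dY.withDensity density) :=
    Gr.continuous_chart.measurable.aemeasurable
  have hfun : knappSteinIntegrand t (noncompactPicture (inducedOf t f)) X = fun Y =>
      Complex.exp ((Real.log (weight X) : ℂ) * (-r + 2 * t)) *
        ((density Y).toReal •
          (sineIntegrand (nuOf K r t) f (Gr.chart X) ∘ Gr.chart) Y) := by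
    ext1 Y
    exact knappSteinIntegrand_eq t f X Y
  constructor
  · rw [hfun, integrable_const_mul_iff (isUnit_iff_ne_zero.2 (Complex.exp_ne_zero _)),
      ← integrable_withDensity_iff_integrable_smul' measurable_density hd,
      ← integrable_map_measure hg hm, h,
      integrable_smul_measure (by simpa using hc) ENNReal.ofReal_ne_top]
  · have h1 : ∫ Y, (density Y).toReal •
        (sineIntegrand (nuOf K r t) f (Gr.chart X) ∘ Gr.chart) Y ∂dY =
        (c : ℂ) * sineTransform μ (nuOf K r t) f (Gr.chart X) := by
      rw [← integral_withDensity_eq_integral_toReal_smul measurable_density hd]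
      simp only [Function.comp_apply]
      rw [← integral_map hm hg, h, integral_smul_measure, ENNReal.toReal_ofReal hc.le,
        Complex.real_smul]
      rfl
    rw [knappStein, hfun, integral_const_mul, h1, noncompactPicture, inducedOf_nbar]
    have h2 : (Real.log (weight X) : ℂ) * (-r + 2 * t) =
      -(Real.log (weight X) : ℂ) * (2 * -t + r) := by ring
    rw [h2]
    ring

end Chart

section L2

variable {μ : Measure (Gr K r)} [IsProbabilityMeasure μ] {ν : ℂ}

theorem norm_sineIntegrand_le (hν : 0 ≤ ν.re) (f : Gr K r → ℂ) (ξ η : Gr K r) :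
    ‖sineIntegrand ν f ξ η‖ ≤ ‖f η‖ := by
  rw [sineIntegrand, norm_mul]
  refine mul_le_of_le_one_left (norm_nonneg _)
    (norm_ofReal_cpow_le_one (sinAngle_nonneg ξ η) (sinAngle_le_one ξ η) ?_)
  simpa using hν

theorem integrable_sineIntegrand (hν : 0 ≤ ν.re) {f : Gr K r → ℂ} (hf : Integrable f μ)
    (ξ : Gr K r) : Integrable (sineIntegrand ν f ξ) μ :=
  hf.mono (aestronglyMeasurable_sineIntegrand ν hf.1 ξ)
    (Filter.Eventually.of_forall (norm_sineIntegrand_le hν f ξ))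

/-- The kernel is bounded by 1, and on a probability space the L¹ norm is at most the L² norm. The
bound is uniform in `ξ`, so it also bounds the L² norm of the transform. -/
theorem norm_sineTransform_le (hν : 0 ≤ ν.re) (f : Lp ℂ 2 μ) (ξ : Gr K r) :
    ‖sineTransform μ ν f ξ‖ ≤ ‖f‖ := by
  have hf : Integrable f μ := (Lp.memLp f).integrable one_le_two
  calc ‖sineTransform μ ν f ξ‖ ≤ ∫ η, ‖f η‖ ∂μ :=
        norm_integral_le_of_norm_le hf.norm
          (Filter.Eventually.of_forall (norm_sineIntegrand_le hν f ξ))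
    _ = (eLpNorm f 1 μ).toReal := by
        rw [integral_norm_eq_lintegral_enorm hf.1, eLpNorm_one_eq_lintegral_enorm]
    _ ≤ (eLpNorm f 2 μ).toReal :=
        ENNReal.toReal_mono (Lp.memLp f).2.ne
          (eLpNorm_le_eLpNorm_of_exponent_le one_le_two hf.1)
    _ = ‖f‖ := (Lp.norm_def f).symm

theorem memLp_sineTransform (hν : 0 ≤ ν.re) (f : Lp ℂ 2 μ) :
    MemLp (sineTransform μ ν f) 2 μ := by
  have hm : StronglyMeasurable (sineTransform μ ν f) := by
    apply StronglyMeasurable.integral_prod_right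
    exact (measurable_sinAngle_cpow (2 * ν)).stronglyMeasurable.mul
      ((Lp.stronglyMeasurable f).comp_measurable measurable_snd)
  exact MemLp.of_bound hm.aestronglyMeasurable ‖f‖
    (Filter.Eventually.of_forall (norm_sineTransform_le hν f))

theorem sineTransform_congr {f g : Gr K r → ℂ} (h : f =ᵐ[μ] g) :
    sineTransform μ ν f = sineTransform μ ν g := by
  ext ξ
  apply integral_congr_ae
  filter_upwards [h] with η hη
  rw [sineIntegrand, sineIntegrand, hη]

/-- The sine transform with `0 ≤ Re ν` as a bounded operator on `L²`. -/
def sineOperator (μ : Measure (Gr K r)) [IsProbabilityMeasure μ] (hν : 0 ≤ ν.re) :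
    Lp ℂ 2 μ →L[ℂ] Lp ℂ 2 μ :=
  LinearMap.mkContinuous
    { toFun := fun f => (memLp_sineTransform hν f).toLp _
      map_add' := fun f g => by
        rw [← MemLp.toLp_add]
        congr 1
        rw [sineTransform_congr (Lp.coeFn_add f g)]
        ext ξ
        have hf := integrable_sineIntegrand hν ((Lp.memLp f).integrable one_le_two) ξ
        have hg := integrable_sineIntegrand hν ((Lp.memLp g).integrable one_le_two) ξ
        rw [Pi.add_apply, sineTransform, sineTransform, sineTransform, ← integral_add hf hg]
        congr 1
        ext η
        simp only [sineIntegrand, Pi.add_apply, mul_add]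
      map_smul' := fun c f => by
        rw [RingHom.id_apply, ← MemLp.toLp_const_smul]
        congr 1
        rw [sineTransform_congr (Lp.coeFn_smul c f)]
        ext ξ
        rw [Pi.smul_apply, sineTransform, sineTransform, ← integral_smul]
        congr 1
        ext η
        simp only [sineIntegrand, Pi.smul_apply, smul_eq_mul]
        ring }
    1 fun f => by
      have h := Lp.norm_le_of_ae_bound (f := (memLp_sineTransform hν f).toLp _) (norm_nonneg f)
        ((MemLp.coeFn_toLp (memLp_sineTransform hν f)).mono fun ξ hξ => by
          rw [hξ]; exact norm_sineTransform_le hν f ξ)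
      simpa [measureUnivNNReal] using h

theorem sineOperator_ae_eq (hν : 0 ≤ ν.re) (f : Lp ℂ 2 μ) :
    sineOperator μ hν f =ᵐ[μ] sineTransform μ ν f :=
  MemLp.coeFn_toLp (memLp_sineTransform hν f)

end L2

end Transform

end SineTransform

end

/-! ### The theorem -/

theorem lemma6p1 {K : Type*} [NormedDivisionRing K] [NormedAlgebra ℝ K] [StarRing K]
    (hK : SineTransform.IsRealComplexOrQuaternion K) (r : ℕ) (hr : 1 ≤ r)
    [MeasurableSpace (Matrix (Fin r) (Fin r) K)] [BorelSpace (Matrix (Fin r) (Fin r) K)]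
    -- `dY`: Lebesgue measure on `M_{r,r}(K)`, in any normalization
    (dY : Measure (Matrix (Fin r) (Fin r) K)) [dY.IsAddHaarMeasure]
    -- `μ`: the invariant probability measure on the Grassmannian
    (μ : Measure (SineTransform.Gr K r)) [IsProbabilityMeasure μ]
    (hμ : SineTransform.IsUInvariant μ) :
    -- the compact picture identifies the induced functions with the functions on `G_{2r,r}(K)`
    (∀ (s : ℂ) (f : SineTransform.Gr K r → ℂ), ∃! φ : SineTransform.GL2r K r → ℂ,
      SineTransform.IsInduced s φ ∧ SineTransform.HasCompactPicture φ f) ∧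
    (∀ (s : ℂ) (φ : SineTransform.GL2r K r → ℂ), SineTransform.IsInduced s φ →
      ∃! f : SineTransform.Gr K r → ℂ, SineTransform.HasCompactPicture φ f) ∧
    -- the non-compact picture sees almost all points of the Grassmannian
    (∀ᵐ ξ ∂μ, ∃ X : Matrix (Fin r) (Fin r) K,
      ξ = SineTransform.Gr.act (SineTransform.nbar X) (SineTransform.Gr.base K r)) ∧
    -- up to a non-zero constant, `I_t` is the sine transform in the compact picture
    (∃ c : ℝ, 0 < c ∧ ∀ (t : ℂ) (f : SineTransform.Gr K r → ℂ), AEStronglyMeasurable f μ →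
      ∀ φ ψ : SineTransform.GL2r K r → ℂ,
        SineTransform.IsInduced t φ → SineTransform.HasCompactPicture φ f →
        SineTransform.IsInduced (-t) ψ →
        SineTransform.HasCompactPicture ψ
          (SineTransform.sineTransform μ (SineTransform.nuOf K r t) f) →
        ∀ X : Matrix (Fin r) (Fin r) K,
          (Integrable (SineTransform.knappSteinIntegrand t
              (SineTransform.noncompactPicture φ) X) dY ↔
            Integrable (SineTransform.sineIntegrand (SineTransform.nuOf K r t) f
              (SineTransform.Gr.act (SineTransform.nbar X) (SineTransform.Gr.base K r))) μ) ∧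
          SineTransform.knappStein dY t (SineTransform.noncompactPicture φ) X =
            (c : ℂ) * SineTransform.noncompactPicture ψ X) ∧
    -- for `ν ≥ 0` the sine transform is a well-defined (bounded) operator on `L²`
    (∀ t : ℂ, 0 ≤ (SineTransform.nuOf K r t).re →
      (∀ f : SineTransform.Gr K r → ℂ, MemLp f 2 μ → ∀ ξ : SineTransform.Gr K r,
        Integrable (SineTransform.sineIntegrand (SineTransform.nuOf K r t) f ξ) μ) ∧
      ∃ T : Lp ℂ 2 μ →L[ℂ] Lp ℂ 2 μ, ∀ f : Lp ℂ 2 μ,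
        T f =ᵐ[μ] SineTransform.sineTransform μ (SineTransform.nuOf K r t) f) := by
  have := hK.isHurwitz
  refine ⟨SineTransform.existsUnique_induced,
    fun _ _ hφ => SineTransform.existsUnique_compactPicture hφ, ?_, ?_, fun t ht => ⟨?_, ?_⟩⟩
  · filter_upwards [SineTransform.ae_mem_range_chart dY hμ] with ξ ⟨X, hX⟩
    exact ⟨X, hX.symm⟩
  · obtain ⟨c, hc, h⟩ := SineTransform.exists_map_chart_eq dY hμ
    refine ⟨c, hc, fun t f hf φ ψ hφ hφf hψ hψf X => ?_⟩
    -- Uniqueness of the induced function with a given compact picture replaces `φ` and `ψ` by the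
    -- explicit formulas.
    rw [hφ.eq_inducedOf hφf, hψ.eq_inducedOf hψf]
    exact SineTransform.knappStein_eq_sineTransform dY hc h t hf X
  · exact fun f hf => SineTransform.integrable_sineIntegrand ht (hf.integrable one_le_two)
  · exact ⟨SineTransform.sineOperator μ ht, SineTransform.sineOperator_ae_eq ht⟩
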